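/- A \emph{probability system} is a triple $(X,\mu,T)$ where $(X,\mu)$ is a probability space and $T\colon X\to X$ is an invertible, bimeasurable, measure-preserving map. For $P_1,\dots,P_k\in\mathbb Z[\mathrm n]$, measurable $f_1,\dots,f_k\colon X\to\mathbb C$ and real $N\ge 1$ put $$A_N^{P_1,\dots,P_k}(f_1,\dots,f_k)(x)=\frac1{\lfloor N\rfloor}\sum_{n=1}^{\lfloor N\rfloor} f_1(T^{P_1(n)}x)\cdots f_k(T^{P_k(n)}x).$$ For $r>0$, a set $\mathbb I\subseteq\mathbb R$ and complex numbers $(a_t)_{t\in\mathbb I}$ put $$\|(a_t)_{t\in\mathbb I}\|_{V^r}=\sup_{J\ge 1}\ \sup_{t_0\le\dots\le t_J,\ t_j\in\mathbb I}\Big(\sum_{j=0}^{J-1}|a_{t_{j+1}}-a_{t_j}|^r\Big)^{1/r}\in[0,\infty],\qquad \|(a_t)_{t\in\mathbb I}\|_{\mathbf V^r}=\sup_{t\in\mathbb I}|a_t|+\|(a_t)_{t\in\mathbb I}\|_{V^r},$$ and let $\|\cdot\|_{L^p(X;V^r)}$ (resp. $\|\cdot\|_{L^p(X;\mathbf V^r)}$)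 be the $L^p(X)$ norm of $x\mapsto \|(a_t(x))_{t\in\mathbb I}\|_{V^r}$ (resp. $\|(a_t(x))_{t\in\mathbb I}\|_{\mathbf V^r}$), with the value $+\infty$ allowed. \textbf{(Failure of the variational estimate for $r\le 2$.)} Let $P_1,\dots,P_k\in\mathbb Z[\mathrm n]$ be polynomials, not all constant, let $0<p_1,\dots,p_k,p\le\infty$ and $0<r\le 2$, and let $\mathbb I\subseteq\{1,2,3,\dots\}$ be an infinite set. Then there is no constant $C>0$ such that $$\|(A_N^{P_1,\dots,P_k}(f_1,\dots,f_k))_{N\in\mathbb I}\|_{L^p(X;V^r)}\le C\,\|f_1\|_{L^{p_1}(X)}\cdots\|f_k\|_{L^{p_k}(X)}$$ for all probability systems $(X,\mu,T)$ and all $f_1\in L^{p_1}(X),\dots,f_k\in L^{p_k}(X)$. \textbf{(Sharpness of $r>2$ in the bilinear long variational ergodic theorem.)} In particular, let $P\in\mathbb Z[\mathrm n]$ have degree at least $2$, let $1<p_1,p_2<\infty$ with $\frac1{p_1}+\frac1{p_2}=\frac1p\le 1$, let $\lambda>1$, let $1\le N_1<N_2<\cdots$ be real numbers with $N_{j+1}/N_j>\lambda$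 for all $j$, put $\mathbb D=\{N_1,N_2,\dots\}$, and let $0<r\le 2$. Then there is no constant $C>0$ such that $$\|(A_N^{\mathrm n,P(\mathrm n)}(f,g))_{N\in\mathbb D}\|_{L^p(X;\mathbf V^r)}\le C\,\|f\|_{L^{p_1}(X)}\|g\|_{L^{p_2}(X)}$$ for all probability systems $(X,\mu,T)$ and all $f\in L^{p_1}(X)$, $g\in L^{p_2}(X)$. -/

import Mathlib

open MeasureTheory
open scoped ENNReal

/-- The non-conventional polynomial ergodic average
`A_N (f₁, …, f_k) (x) = ⌊N⌋⁻¹ ∑_{1 ≤ n ≤ ⌊N⌋} f₁ (T ^ P₁(n) x) ⋯ f_k (T ^ P_k(n) x)`, for a real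
number `N ≥ 1`. The powers of the invertible map `T` are powers with integer exponents in the group
of permutations of `X`. -/
noncomputable def polyErgodicAverage {X : Type*} [MeasurableSpace X] (T : X ≃ᵐ X) {k : ℕ}
    (P : Fin k → Polynomial ℤ) (f : Fin k → X → ℂ) (N : ℝ) (x : X) : ℂ :=
  (⌊N⌋₊ : ℂ)⁻¹ * ∑ n ∈ Finset.Icc 1 ⌊N⌋₊,
    ∏ i, f i (((T.toEquiv : Equiv.Perm X) ^ ((P i).eval (n : ℤ))) x)

/-- The `r`-variation seminorm of `(a t)`, `t ∈ I`: the supremum of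
`(∑_{j < J} |a (t_{j+1}) - a (t_j)| ^ r) ^ (1 / r)` over all `J ≥ 1` and all
`t_0 ≤ ⋯ ≤ t_J` in `I`, as an extended nonnegative real. It is zero when `I` is empty. -/
noncomputable def rVariation {ι : Type*} [LinearOrder ι] (r : ℝ) (I : Set ι) (a : ι → ℂ) : ℝ≥0∞ :=
  ⨆ (J : ℕ) (_ : 1 ≤ J) (t : Fin (J + 1) → ι) (_ : Monotone t) (_ : ∀ j, t j ∈ I),
    (∑ j : Fin J, ‖a (t j.succ) - a (t j.castSucc)‖ₑ ^ r) ^ (1 / r)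

/-- The full `r`-variation norm: the supremum norm plus the `r`-variation seminorm. -/
noncomputable def rVariationNorm {ι : Type*} [LinearOrder ι] (r : ℝ) (I : Set ι) (a : ι → ℂ) :
    ℝ≥0∞ :=
  (⨆ t ∈ I, ‖a t‖ₑ) + rVariation r I a

/-! The obstruction is that a random walk has unbounded quadratic variation at its natural scale.
One function is tested along a nonconstant `P i₀`, all others being `1`, on a rotation of a torus of
large dimension `J`. The test function is half the Riesz product of the factors `1 + i δ cos (2π
θ_i)` with `δ² J = 1`; it is bounded by `1`.

Polynomial exponential averages tend to zero in L², hence almost everywhere along a subsequence of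
the given infinite set. This allows times and frequencies to be chosen alternately
(`exists_frequencies`), so that the average at time `N j` is nearly half the product over the
indices `i ≥ j`. An increment between two times is thus governed by the product over a block of
indices: every factor has modulus at least `1`, so the increment is large when the argument of the
block product, `δ` times a sum of independent symmetric variables, is not small.

A sum of `n` such variables exceeds a large multiple of `√n` with a small but fixed probability.
Each point lies in dyadic blocks of many scales, whose siblings are independent, so with high
probability one of these blocks has squared increment at least a constant times `2 ^ b δ²` times its
length (`exists_measureReal_forall_block_le`). Maximal blocks of this kind cover half of all points
on a set of measure at least `1/2`, and a stopping partition (`exists_partition_sum_sq_ge`) yields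
squared increments summing to at least `2 ^ b / 6144`, with `b` arbitrary. Bounded increments turn
this into a bound for every `r ≤ 2`. The bilinear case follows by passing to integer parts of the
times. -/

/-! ### Exponential sum averages on the circle -/

/-- The integral of a character of the circle. -/
lemma integral_fourier_eq (m : ℤ) :
    ∫ t : UnitAddCircle, (fourier m t : ℂ) ∂AddCircle.haarAddCircle = if m = 0 then 1 else 0 := by
  split_ifs with h
  · subst h
    simp
  · exact integral_eq_zero_of_add_right_eq_neg (μ := AddCircle.haarAddCircle)
      (fourier_add_half_inv_index h zero_lt_one)

/-- The exponential sum average `N⁻¹ ∑_{1 ≤ n ≤ N} e(P(n) β)`. -/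
noncomputable def expAvg (P : Polynomial ℤ) (N : ℕ) (β : UnitAddCircle) : ℂ :=
  (N : ℂ)⁻¹ * ∑ n ∈ Finset.Icc 1 N, (fourier (P.eval (n : ℤ)) β : ℂ)

lemma continuous_expAvg (P : Polynomial ℤ) (N : ℕ) : Continuous (expAvg P N) := by
  unfold expAvg
  exact continuous_const.mul (continuous_finsetSum _ fun n _ => (fourier _).continuous)

lemma expAvg_zero (P : Polynomial ℤ) {N : ℕ} (hN : 1 ≤ N) : expAvg P N 0 = 1 := by
  have : (N : ℂ) ≠ 0 := by exact_mod_cast (by omega : N ≠ 0)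
  simp only [expAvg, fourier_eval_zero]
  simp [this]

lemma card_eval_eq_le (P : Polynomial ℤ) (hP : P.natDegree ≠ 0) (N : ℕ) (c : ℤ) :
    ((Finset.Icc 1 N).filter fun m : ℕ => P.eval (m : ℤ) = c).card ≤ P.natDegree := by
  have h0 : P - Polynomial.C c ≠ 0 := by
    intro h
    apply hP
    rw [sub_eq_zero.1 h, Polynomial.natDegree_C]
  calc _ ≤ (P - Polynomial.C c).roots.toFinset.card := by
        refine Finset.card_le_card_of_injOn (fun m : ℕ => (m : ℤ)) ?_ ?_
        · intro m hm
          have := (Finset.mem_filter.1 hm).2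
          simp only [Finset.mem_coe, Multiset.mem_toFinset]
          rw [Polynomial.mem_roots h0]
          simp [this]
        · intro a _ b _ h
          exact Int.ofNat_injective h
    _ ≤ Multiset.card (P - Polynomial.C c).roots := Multiset.toFinset_card_le _
    _ ≤ (P - Polynomial.C c).natDegree := Polynomial.card_roots' _
    _ = P.natDegree := Polynomial.natDegree_sub_C

/-- Orthogonality of characters reduces the integral to counting the pairs with `P(m) = P(n)`; each
`n` has at most `natDegree` partners `m`. -/
lemma integral_norm_expAvg_sq_le (P : Polynomial ℤ) (hP : P.natDegree ≠ 0) {N : ℕ} (hN : 1 ≤ N) :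
    ∫ t, ‖expAvg P N t‖ ^ 2 ∂AddCircle.haarAddCircle ≤ P.natDegree / N := by
  have hN0 : (N : ℝ) ≠ 0 := by exact_mod_cast (by omega : N ≠ 0)
  have key : ((∫ t, ‖expAvg P N t‖ ^ 2 ∂AddCircle.haarAddCircle : ℝ) : ℂ) =
      (((N : ℝ)⁻¹ ^ 2 * ∑ n ∈ Finset.Icc 1 N,
        (((Finset.Icc 1 N).filter fun m : ℕ => P.eval (m : ℤ) = P.eval (n : ℤ)).card : ℝ) : ℝ) :
        ℂ) := by
    rw [← integral_complex_ofReal]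
    have h1 : ∀ t, ((‖expAvg P N t‖ ^ 2 : ℝ) : ℂ) = (N : ℂ)⁻¹ ^ 2 * ∑ n ∈ Finset.Icc 1 N,
        ∑ m ∈ Finset.Icc 1 N, (fourier (P.eval (m : ℤ) - P.eval (n : ℤ)) t : ℂ) := by
      intro t
      rw [Complex.ofReal_pow, ← Complex.mul_conj', expAvg, map_mul, map_sum, map_inv₀,
        Complex.conj_natCast]
      simp_rw [← fourier_neg]
      rw [mul_mul_mul_comm, ← sq, Finset.sum_mul_sum, Finset.sum_comm]
      simp_rw [← fourier_add, ← sub_eq_add_neg]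
    simp_rw [h1]
    have hi : ∀ m : ℤ, Integrable (fun t : UnitAddCircle => (fourier m t : ℂ))
        AddCircle.haarAddCircle := fun m =>
      (fourier m).continuous.integrable_of_hasCompactSupport (HasCompactSupport.of_compactSpace _)
    rw [integral_const_mul, integral_finsetSum _ fun n _ => integrable_finsetSum _ fun m _ => hi _]
    simp_rw [integral_finsetSum _ fun m _ => hi _, integral_fourier_eq]
    push_cast
    congr 1
    refine Finset.sum_congr rfl fun n _ => ?_
    rw [Finset.sum_ite]
    simp [sub_eq_zero]
  have key' := Complex.ofReal_injective key
  rw [key']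
  have : ∑ n ∈ Finset.Icc 1 N, (((Finset.Icc 1 N).filter
      fun m : ℕ => P.eval (m : ℤ) = P.eval (n : ℤ)).card : ℝ) ≤ N * P.natDegree := by
    calc _ ≤ ∑ n ∈ Finset.Icc 1 N, (P.natDegree : ℝ) :=
          Finset.sum_le_sum fun n _ => by exact_mod_cast card_eval_eq_le P hP N _
      _ = _ := by simp
  calc _ ≤ (N : ℝ)⁻¹ ^ 2 * (N * P.natDegree) := by gcongr
    _ = _ := by field_simp

open Filter Topology in
/-- Along a suitable sequence in an infinite set, the exponential averages tend to zero almost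
everywhere. -/
lemma exists_seq_expAvg_tendsto (P : Polynomial ℤ) (hP : P.natDegree ≠ 0) (I : Set ℕ)
    (hI : I.Infinite) (hI1 : ∀ N ∈ I, 1 ≤ N) :
    ∃ s : ℕ → ℕ, StrictMono s ∧ (∀ n, s n ∈ I) ∧
      ∀ᵐ β ∂(AddCircle.haarAddCircle (T := (1 : ℝ))),
        Tendsto (fun n => expAvg P (s n) β) atTop (𝓝 0) := by
  let u : ℕ → ℕ := Nat.nth (· ∈ I)
  have hu : StrictMono u := Nat.nth_strictMono hI
  have huI : ∀ n, u n ∈ I := fun n => Nat.nth_mem_of_infinite hI n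
  -- L² decay gives convergence in measure, which suffices for almost everywhere convergence along a
  -- subsequence, whatever the set `I` is.
  have hm : TendstoInMeasure (AddCircle.haarAddCircle (T := (1 : ℝ)))
      (fun n => expAvg P (u n)) atTop (fun _ => (0 : ℂ)) := by
    refine tendstoInMeasure_of_tendsto_eLpNorm (p := 2) (by norm_num)
      (fun n => (continuous_expAvg P _).aestronglyMeasurable) aestronglyMeasurable_const ?_
    have h : ∀ n, eLpNorm (expAvg P (u n) - fun _ => (0 : ℂ)) 2
        (AddCircle.haarAddCircle (T := (1 : ℝ))) ≤
        ENNReal.ofReal ((P.natDegree / (u n : ℝ)) ^ (1 / 2 : ℝ)) := by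
      intro n
      have hL : MemLp (expAvg P (u n)) 2 (AddCircle.haarAddCircle (T := (1 : ℝ))) :=
        (continuous_expAvg P _).memLp_of_hasCompactSupport (HasCompactSupport.of_compactSpace _)
      have h0 : (expAvg P (u n) - fun _ => (0 : ℂ)) = expAvg P (u n) := by ext; simp
      rw [h0, hL.eLpNorm_eq_integral_rpow_norm (by norm_num) (by norm_num)]
      refine ENNReal.ofReal_le_ofReal ?_
      have := integral_norm_expAvg_sq_le P hP (hI1 _ (huI n))
      simp only [ENNReal.toReal_ofNat, Real.rpow_ofNat, ← one_div]
      refine Real.rpow_le_rpow (integral_nonneg fun _ => by positivity) this (by norm_num)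
    refine tendsto_of_tendsto_of_tendsto_of_le_of_le tendsto_const_nhds ?_ (fun _ => zero_le) h
    rw [← ENNReal.ofReal_zero]
    refine ENNReal.tendsto_ofReal ?_
    have h2 : Tendsto (fun n => (P.natDegree : ℝ) / (u n : ℝ)) atTop (𝓝 0) :=
      tendsto_const_nhds.div_atTop (tendsto_natCast_atTop_atTop.comp hu.tendsto_atTop)
    have := h2.rpow_const (p := 1 / 2) (Or.inr (by norm_num))
    simpa using this
  obtain ⟨ns, hns, h⟩ := hm.exists_seq_tendsto_ae
  exact ⟨u ∘ ns, hu.comp hns, fun n => huI _, h⟩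

/-! ### Inductive choice of times and frequencies -/

/-- The integer vectors all of whose coordinates are `-1`, `0` or `1`. -/
noncomputable def signBox (J : ℕ) : Finset (Fin J → ℤ) := Fintype.piFinset fun _ => Finset.Icc (-1 : ℤ) 1

lemma ae_add_zsmul_of_ae {G : UnitAddCircle → Prop}
    (hG : ∀ᵐ β ∂(AddCircle.haarAddCircle (T := (1 : ℝ))), G β) (c : UnitAddCircle) {k : ℤ}
    (hk : k ∈ Finset.Icc (-1 : ℤ) 1) (hk0 : k ≠ 0) :
    ∀ᵐ a ∂(AddCircle.haarAddCircle (T := (1 : ℝ))), G (c + k • a) := by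
  have : k = -1 ∨ k = 1 := by
    have := Finset.mem_Icc.1 hk
    omega
  rcases this with rfl | rfl
  · have := (Measure.measurePreserving_sub_left (AddCircle.haarAddCircle (T := (1 : ℝ)))
      c).quasiMeasurePreserving.ae hG
    simpa [sub_eq_add_neg] using this
  · have := (measurePreserving_add_left (AddCircle.haarAddCircle (T := (1 : ℝ)))
      c).quasiMeasurePreserving.ae hG
    simpa using this

open Filter Topology in
/-- There are frequencies `α i` and times `N j` such that the average up to time `N j` kills the
characters that involve one of the first `j` frequencies, and preserves the others. -/
lemma exists_frequencies (P : Polynomial ℤ) (hP : P.natDegree ≠ 0) (I : Set ℕ)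
    (hI : I.Infinite) (hI1 : ∀ N ∈ I, 1 ≤ N) {ε : ℝ} (hε : 0 < ε) (J : ℕ) :
    ∃ (N : ℕ → ℕ) (α : Fin J → UnitAddCircle), (∀ j ≤ J, N j ∈ I) ∧ (∀ j < J, N j < N (j + 1)) ∧
      ∀ j ≤ J, ∀ m ∈ signBox J, ‖expAvg P (N j) (∑ i, m i • α i) -
        if ∀ i : Fin J, i.val < j → m i = 0 then 1 else 0‖ < ε := by
  obtain ⟨s, hs, hsI, hG⟩ := exists_seq_expAvg_tendsto P hP I hI hI1
  -- The induction also carries genericity of all nonzero combinations of the frequencies along the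
  -- fixed sequence `s`, so that a later time can kill all of them at once.
  suffices H : ∃ (N : ℕ → ℕ) (α : Fin J → UnitAddCircle), (∀ j ≤ J, N j ∈ I) ∧
      (∀ j < J, N j < N (j + 1)) ∧
      (∀ j ≤ J, ∀ m ∈ signBox J, ‖expAvg P (N j) (∑ i, m i • α i) -
        if ∀ i : Fin J, i.val < j → m i = 0 then 1 else 0‖ < ε) ∧
      ∀ m ∈ signBox J, m ≠ 0 → Tendsto (fun n => expAvg P (s n) (∑ i, m i • α i)) atTop (𝓝 0) by
    obtain ⟨N, α, h1, h2, h3, -⟩ := H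
    exact ⟨N, α, h1, h2, h3⟩
  induction J with
  | zero =>
    refine ⟨fun _ => s 0, Fin.elim0, fun _ _ => hsI 0, fun j hj => absurd hj (by omega), ?_, ?_⟩
    · intro j _ m _
      simp [expAvg_zero P (hI1 _ (hsI 0)), hε]
    · intro m _ hm
      exact absurd (Subsingleton.elim _ _) hm
  | succ J ih =>
    obtain ⟨N, α, h1, h2, h3, h4⟩ := ih
    have hbox : ∀ m ∈ signBox (J + 1), (fun i : Fin J => m i.castSucc) ∈ signBox J := by
      intro m hm
      simp only [signBox, Fintype.mem_piFinset] at hm ⊢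
      exact fun i => hm _
    -- A new frequency close to `0` does not disturb the finitely many earlier averages: at `a = 0`
    -- the claim is the induction hypothesis, and everything is continuous.
    have hA : ∀ᶠ a in 𝓝 (0 : UnitAddCircle), ∀ j ∈ Finset.range (J + 1), ∀ m ∈ signBox (J + 1),
        ‖expAvg P (N j) ((∑ i : Fin J, m i.castSucc • α i) + m (Fin.last J) • a) -
          if ∀ i : Fin J, i.val < j → m i.castSucc = 0 then 1 else 0‖ < ε := by
      rw [Finset.eventually_all]
      intro j hj
      rw [Finset.eventually_all]
      intro m hm
      have hc : Continuous fun a : UnitAddCircle =>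
          ‖expAvg P (N j) ((∑ i : Fin J, m i.castSucc • α i) + m (Fin.last J) • a) -
          if ∀ i : Fin J, i.val < j → m i.castSucc = 0 then 1 else 0‖ :=
        (((continuous_expAvg P (N j)).comp
          (continuous_const.add (continuous_zsmul _))).sub continuous_const).norm
      refine hc.continuousAt.eventually_lt continuousAt_const ?_
      simpa using h3 j (by simpa [Nat.lt_succ_iff] using hj) _ (hbox m hm)
    have hB : ∀ᵐ a ∂(AddCircle.haarAddCircle (T := (1 : ℝ))), ∀ m ∈ signBox (J + 1), m ≠ 0 →
        Tendsto (fun n => expAvg P (s n)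
          ((∑ i : Fin J, m i.castSucc • α i) + m (Fin.last J) • a)) atTop (𝓝 0) := by
      rw [Finset.eventually_all]
      intro m hm
      by_cases hl : m (Fin.last J) = 0
      · refine Eventually.of_forall fun a hm0 => ?_
        rw [hl]
        simp only [zero_smul, add_zero]
        refine h4 _ (hbox m hm) fun h => hm0 ?_
        funext i
        refine Fin.lastCases hl (fun i => ?_) i
        exact congrFun h i
      · refine (ae_add_zsmul_of_ae hG _ ?_ hl).mono fun a ha _ => ha
        exact Fintype.mem_piFinset.1 hm _
    -- A set of full measure is dense, so it meets the neighbourhood of `0` from `hA`.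
    obtain ⟨a, haA, haB⟩ : ∃ a, _ ∧ _ :=
      (Measure.dense_of_ae hB).inter_nhds_nonempty hA
    have hC : ∀ᶠ n in atTop, ∀ m ∈ signBox (J + 1), m ≠ 0 → ‖expAvg P (s n)
          ((∑ i : Fin J, m i.castSucc • α i) + m (Fin.last J) • a)‖ < ε := by
      rw [Finset.eventually_all]
      intro m hm
      by_cases hm0 : m = 0
      · exact Eventually.of_forall fun _ h => absurd hm0 h
      have := (haA m hm hm0).norm
      rw [norm_zero] at this
      filter_upwards [this.eventually_lt_const hε] with n hn _ using hn
    obtain ⟨n, hn, hnN⟩ := (hC.and (hs.tendsto_atTop.eventually_gt_atTop (N J))).exists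
    have hsum : ∀ m : Fin (J + 1) → ℤ,
        ∑ i, m i • (Fin.snoc α a : Fin (J + 1) → UnitAddCircle) i =
          (∑ i : Fin J, m i.castSucc • α i) + m (Fin.last J) • a := by
      intro m
      simp [Fin.sum_univ_castSucc]
    refine ⟨fun j => if j ≤ J then N j else s n, Fin.snoc α a, ?_, ?_, ?_, ?_⟩
    · intro j hj
      dsimp only
      split_ifs with h
      exacts [h1 j h, hsI n]
    · intro j hj
      rcases Nat.lt_succ_iff_lt_or_eq.1 hj with h | rfl
      · simpa [h.le, Nat.succ_le_of_lt h] using h2 j h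
      · simpa using hnN
    · intro j hj m hm
      rw [hsum]
      by_cases h : j ≤ J
      · have := haB j (by simpa [Nat.lt_succ_iff] using h) m hm
        have e : (∀ i : Fin (J + 1), i.val < j → m i = 0) ↔
            ∀ i : Fin J, i.val < j → m i.castSucc = 0 := by
          rw [Fin.forall_fin_succ']
          simp [h]
        simpa only [if_pos h, e] using this
      · have hj' : j = J + 1 := by omega
        have e : (∀ i : Fin (J + 1), i.val < j → m i = 0) ↔ m = 0 := by
          subst hj'
          exact ⟨fun hh => funext fun i => hh i i.2, fun hh i _ => by simp [hh]⟩
        simp only [if_neg h, e]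
        by_cases hm0 : m = 0
        · simp [hm0, expAvg_zero P (hI1 _ (hsI n)), hε]
        · simpa [hm0] using hn m hm hm0
    · intro m hm hm0
      simp_rw [hsum]
      exact haA m hm hm0

/-! ### Riesz products and their averages -/

/-- The cosine function `t ↦ cos (2 π t)` on the circle `ℝ / ℤ`. -/
noncomputable def circleCos (t : UnitAddCircle) : ℝ := (fourier 1 t : ℂ).re

/-- The Riesz product `∏_{i ∈ s} (1 + i δ cos (2 π θ_i))`. -/
noncomputable def rieszProd {J : ℕ} (δ : ℝ) (s : Finset (Fin J)) (θ : Fin J → UnitAddCircle) : ℂ :=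
  ∏ i ∈ s, (1 + ((δ * circleCos (θ i) : ℝ) : ℂ) * Complex.I)

/-- The Fourier coefficients of a factor of the Riesz product. -/
noncomputable def rieszCoeff (δ : ℝ) (k : ℤ) : ℂ := if k = 0 then 1 else (δ / 2 : ℝ) * Complex.I

lemma norm_rieszCoeff_le {δ : ℝ} (hδ : |δ| ≤ 2) (k : ℤ) : ‖rieszCoeff δ k‖ ≤ 1 := by
  unfold rieszCoeff
  split_ifs
  · simp
  · rw [norm_mul, Complex.norm_I, mul_one, Complex.norm_real, Real.norm_eq_abs, abs_div]
    norm_num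
    linarith

lemma sum_rieszCoeff_mul_fourier (δ : ℝ) (t : UnitAddCircle) :
    ∑ k ∈ Finset.Icc (-1 : ℤ) 1, rieszCoeff δ k * (fourier k t : ℂ) =
      1 + ((δ * circleCos t : ℝ) : ℂ) * Complex.I := by
  have h : Finset.Icc (-1 : ℤ) 1 = {-1, 0, 1} := by decide
  rw [h, Finset.sum_insert (by decide), Finset.sum_insert (by decide), Finset.sum_singleton,
    fourier_neg, fourier_zero]
  have := Complex.add_conj (fourier 1 t : ℂ)
  simp only [rieszCoeff, circleCos]
  norm_num only
  simp only [if_true, if_false]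
  push_cast at this ⊢
  linear_combination (δ / 2 * Complex.I) * this

/-- Requiring `m i = 0` off `s` lets the products over all subsets be expanded over the same box of
characters, so that they can be compared term by term. -/
lemma rieszProd_eq_sum {J : ℕ} (δ : ℝ) (s : Finset (Fin J)) (θ : Fin J → UnitAddCircle) :
    rieszProd δ s θ = ∑ m ∈ signBox J, if ∀ i, i ∉ s → m i = 0 then
      ∏ i, rieszCoeff δ (m i) * (fourier (m i) (θ i) : ℂ) else 0 := by
  have h : rieszProd δ s θ = ∏ i, ∑ k ∈ Finset.Icc (-1 : ℤ) 1,
      if i ∉ s → k = 0 then rieszCoeff δ k * (fourier k (θ i) : ℂ) else 0 := by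
    rw [rieszProd, ← Finset.prod_subset (Finset.subset_univ s)]
    · refine Finset.prod_congr rfl fun i hi => ?_
      simp only [hi, not_true_eq_false, false_imp_iff, if_true]
      exact (sum_rieszCoeff_mul_fourier δ _).symm
    · intro i _ hi
      simp only [hi, not_false_eq_true, true_imp_iff]
      rw [Finset.sum_ite_eq']
      simp [rieszCoeff]
  rw [h, Finset.prod_univ_sum]
  refine Finset.sum_congr rfl fun m _ => ?_
  rw [Finset.prod_ite_zero]
  simp

/-- The average of a Riesz product over a polynomial orbit of a rotation of the torus. -/
lemma average_rieszProd_eq_sum (P : Polynomial ℤ) (N : ℕ) {J : ℕ} (δ : ℝ)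
    (α θ : Fin J → UnitAddCircle) :
    (N : ℂ)⁻¹ * ∑ n ∈ Finset.Icc 1 N,
      rieszProd δ Finset.univ (P.eval (n : ℤ) • α + θ) =
      ∑ m ∈ signBox J, (∏ i, rieszCoeff δ (m i) * (fourier (m i) (θ i) : ℂ)) *
        expAvg P N (∑ i, m i • α i) := by
  have hf : ∀ (z : ℤ) (m : Fin J → ℤ), ∏ i, (fourier (m i) ((z • α + θ) i) : ℂ) =
      (∏ i, (fourier (m i) (θ i) : ℂ)) * fourier z (∑ i, m i • α i) := by
    intro z m
    have h1 : ∀ s : Finset (Fin J), (fourier z (∑ i ∈ s, m i • α i) : ℂ) =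
        ∏ i ∈ s, (fourier (m i) (z • α i) : ℂ) := by
      intro s
      induction s using Finset.induction_on with
      | empty => simp
      | insert i s hi ih =>
        rw [Finset.sum_insert hi, Finset.prod_insert hi, ← ih]
        simp only [fourier_apply, smul_add, AddCircle.toCircle_add, Circle.coe_mul]
        rw [smul_comm]
    rw [h1, ← Finset.prod_mul_distrib]
    refine Finset.prod_congr rfl fun i _ => ?_
    simp only [fourier_apply, Pi.add_apply, Pi.smul_apply, smul_add, AddCircle.toCircle_add,
      Circle.coe_mul]
    ring
  simp_rw [rieszProd_eq_sum]
  rw [Finset.sum_comm, Finset.mul_sum]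
  refine Finset.sum_congr rfl fun m _ => ?_
  simp only [Finset.mem_univ, not_true_eq_false, false_imp_iff, implies_true, if_true]
  simp_rw [Finset.prod_mul_distrib, hf, expAvg, Finset.mul_sum]
  refine Finset.sum_congr rfl fun n _ => ?_
  ring

/-- The average multiplies each character by a number within `ε` of `1` or `0`, and those kept are
exactly the characters of the partial product. All coefficients have modulus at most `1`, so the
errors add up to `ε` times the number of characters. -/
lemma norm_average_sub_rieszProd_le (P : Polynomial ℤ) (N : ℕ) {J j : ℕ} {δ ε : ℝ} (hδ : |δ| ≤ 2)
    (α : Fin J → UnitAddCircle)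
    (h : ∀ m ∈ signBox J, ‖expAvg P N (∑ i, m i • α i) -
        if ∀ i : Fin J, i.val < j → m i = 0 then 1 else 0‖ < ε) (θ : Fin J → UnitAddCircle) :
    ‖(N : ℂ)⁻¹ * ∑ n ∈ Finset.Icc 1 N, rieszProd δ Finset.univ (P.eval (n : ℤ) • α + θ) -
      rieszProd δ (Finset.univ.filter fun i : Fin J => j ≤ i.val) θ‖ ≤ (signBox J).card * ε := by
  rw [average_rieszProd_eq_sum, rieszProd_eq_sum, ← Finset.sum_sub_distrib]
  have h1 : ∀ m ∈ signBox J, ‖(∏ i, rieszCoeff δ (m i) * (fourier (m i) (θ i) : ℂ)) *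
        expAvg P N (∑ i, m i • α i) -
      if ∀ i, i ∉ (Finset.univ.filter fun i : Fin J => j ≤ i.val) → m i = 0 then
        ∏ i, rieszCoeff δ (m i) * (fourier (m i) (θ i) : ℂ) else 0‖ ≤ ε := by
    intro m hm
    have e : (if ∀ i, i ∉ (Finset.univ.filter fun i : Fin J => j ≤ i.val) → m i = 0 then
        ∏ i, rieszCoeff δ (m i) * (fourier (m i) (θ i) : ℂ) else 0) =
        (∏ i, rieszCoeff δ (m i) * (fourier (m i) (θ i) : ℂ)) *
          if ∀ i : Fin J, i.val < j → m i = 0 then 1 else 0 := by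
      simp
    rw [e, ← mul_sub, norm_mul, norm_prod]
    have h2 : ∏ i, ‖rieszCoeff δ (m i) * (fourier (m i) (θ i) : ℂ)‖ ≤ 1 := by
      refine Finset.prod_le_one (fun _ _ => norm_nonneg _) fun i _ => ?_
      rw [norm_mul, fourier_apply, Circle.norm_coe, mul_one]
      exact norm_rieszCoeff_le hδ _
    calc _ ≤ 1 * ε := mul_le_mul h2 (h m hm).le (norm_nonneg _) zero_le_one
      _ = ε := one_mul _
  refine (norm_sum_le_of_le _ h1).trans ?_
  simp

/-! ### A dyadic stopping partition -/

/-- A sequence has a partition of a dyadic interval whose sum of squared increments is at least `κ`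
times the number of points that are covered by dyadic subintervals on which the squared increment is
at least `κ` times the length. -/
lemma exists_partition_sum_sq_ge (A : ℕ → ℂ) {κ : ℝ} (hκ : 0 ≤ κ) (k a : ℕ) :
    ∃ (L : ℕ) (t : ℕ → ℕ), Monotone t ∧ t 0 = a * 2 ^ k ∧ t L = (a + 1) * 2 ^ k ∧
      κ * ((Finset.Ico (a * 2 ^ k) ((a + 1) * 2 ^ k)).filter fun x => ∃ l ≤ k,
        κ * 2 ^ l ≤ ‖A ((x / 2 ^ l + 1) * 2 ^ l) - A (x / 2 ^ l * 2 ^ l)‖ ^ 2).card ≤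
      ∑ j ∈ Finset.range L, ‖A (t (j + 1)) - A (t j)‖ ^ 2 := by
  induction k generalizing a with
  | zero =>
    refine ⟨1, fun j => if j = 0 then a else a + 1, ?_, by simp, by simp, ?_⟩
    · intro i j hij
      dsimp only
      split_ifs <;> omega
    · rw [Finset.sum_range_one]
      by_cases hg : κ ≤ ‖A (a + 1) - A a‖ ^ 2
      · simp only [zero_add, one_ne_zero, if_false, if_true]
        refine le_trans ?_ hg
        refine mul_le_of_le_one_right hκ ?_
        refine (Nat.cast_le.2 (Finset.card_filter_le _ _)).trans ?_
        simp
      · simp only [zero_add, one_ne_zero, if_false, if_true]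
        rw [Finset.filter_eq_empty_iff.2]
        · simp
        · rintro x hx ⟨l, hl, h⟩
          have : x = a := by
            have := Finset.mem_Ico.1 hx
            omega
          obtain rfl : l = 0 := by omega
          subst this
          exact hg (by simpa using h)
  | succ k ih =>
    -- Stopping rule: if the whole interval has a large increment, keep it as a single step;
    -- otherwise partition both halves and concatenate.
    by_cases hg : κ * 2 ^ (k + 1) ≤ ‖A ((a + 1) * 2 ^ (k + 1)) - A (a * 2 ^ (k + 1))‖ ^ 2
    · refine ⟨1, fun j => if j = 0 then a * 2 ^ (k + 1) else (a + 1) * 2 ^ (k + 1), ?_, by simp,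
        by simp, ?_⟩
      · intro i j hij
        dsimp only
        split_ifs
        · exact le_rfl
        · exact Nat.mul_le_mul_right _ (by omega)
        · omega
        · exact le_rfl
      · rw [Finset.sum_range_one]
        simp only [zero_add, one_ne_zero, if_false, if_true]
        refine le_trans (mul_le_mul_of_nonneg_left ?_ hκ) hg
        refine (Nat.cast_le.2 (Finset.card_filter_le _ _)).trans ?_
        rw [Nat.card_Ico, add_mul, one_mul, Nat.add_sub_cancel_left]
        simp
    · obtain ⟨L₁, t₁, hm₁, h0₁, hL₁, hs₁⟩ := ih (2 * a)
      obtain ⟨L₂, t₂, hm₂, h0₂, hL₂, hs₂⟩ := ih (2 * a + 1)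
      have hmid : t₁ L₁ = t₂ 0 := by rw [hL₁, h0₂]
      refine ⟨L₁ + L₂, fun j => if j ≤ L₁ then t₁ j else t₂ (j - L₁), ?_, ?_, ?_, ?_⟩
      · intro i j hij
        dsimp only
        split_ifs with h1 h2 h2
        · exact hm₁ hij
        · exact (hm₁ h1).trans (hmid.le.trans (hm₂ (Nat.zero_le _)))
        · omega
        · exact hm₂ (by omega)
      · simp [h0₁, pow_succ]
        ring
      · by_cases h : L₂ = 0
        · subst h
          simp only [add_zero, le_refl, if_true]
          rw [hmid, hL₂]
          ring
        · dsimp only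
          rw [if_neg (by omega), Nat.add_sub_cancel_left, hL₂]
          ring
      · rw [Finset.sum_range_add]
        have e₁ : ∑ j ∈ Finset.range L₁, ‖A ((fun j => if j ≤ L₁ then t₁ j else t₂ (j - L₁)) (j + 1))
            - A ((fun j => if j ≤ L₁ then t₁ j else t₂ (j - L₁)) j)‖ ^ 2 =
            ∑ j ∈ Finset.range L₁, ‖A (t₁ (j + 1)) - A (t₁ j)‖ ^ 2 := by
          refine Finset.sum_congr rfl fun j hj => ?_
          have := Finset.mem_range.1 hj
          simp only [if_pos (show j + 1 ≤ L₁ by omega), if_pos (show j ≤ L₁ by omega)]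
        have e₂ : ∑ j ∈ Finset.range L₂,
            ‖A ((fun j => if j ≤ L₁ then t₁ j else t₂ (j - L₁)) (L₁ + j + 1))
            - A ((fun j => if j ≤ L₁ then t₁ j else t₂ (j - L₁)) (L₁ + j))‖ ^ 2 =
            ∑ j ∈ Finset.range L₂, ‖A (t₂ (j + 1)) - A (t₂ j)‖ ^ 2 := by
          refine Finset.sum_congr rfl fun j hj => ?_
          have e : (if L₁ + j ≤ L₁ then t₁ (L₁ + j) else t₂ (L₁ + j - L₁)) = t₂ j := by
            by_cases h : j = 0
            · subst h
              simp [hmid]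
            · rw [if_neg (by omega), Nat.add_sub_cancel_left]
          simp only [e]
          rw [if_neg (show ¬ L₁ + j + 1 ≤ L₁ by omega), show L₁ + j + 1 - L₁ = j + 1 by omega]
        simp only [add_assoc] at e₁ e₂ ⊢
        rw [e₁, e₂]
        refine le_trans ?_ (add_le_add hs₁ hs₂)
        rw [← mul_add]
        refine mul_le_mul_of_nonneg_left ?_ hκ
        rw [← Nat.cast_add, Nat.cast_le]
        refine le_trans (Finset.card_le_card ?_) (Finset.card_union_le _ _)
        intro x hx
        rw [Finset.mem_filter, Finset.mem_Ico] at hx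
        obtain ⟨⟨hx1, hx2⟩, l, hl, h⟩ := hx
        -- The top scale failed, so the interval witnessing that `x` is covered lies in one of the
        -- halves.
        have hlk : l ≤ k := by
          rcases Nat.le_succ_iff_eq_or_le.1 hl with rfl | h'
          · exfalso
            have : x / 2 ^ (k + 1) = a := by
              rw [Nat.div_eq_iff (by positivity)]
              constructor
              · exact hx1
              · rw [add_mul] at hx2
                omega
            rw [this] at h
            exact hg h
          · exact h'
        rw [Finset.mem_union, Finset.mem_filter, Finset.mem_filter, Finset.mem_Ico, Finset.mem_Ico]
        have e1 : a * 2 ^ (k + 1) = 2 * a * 2 ^ k := by ring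
        have e2 : (a + 1) * 2 ^ (k + 1) = (2 * a + 1 + 1) * 2 ^ k := by ring
        by_cases hx' : x < (2 * a + 1) * 2 ^ k
        · exact Or.inl ⟨⟨by omega, hx'⟩, l, hlk, h⟩
        · exact Or.inr ⟨⟨by omega, by omega⟩, l, hlk, h⟩

/-! ### Large values of sums of independent bounded symmetric variables -/

section BoundedSums

variable {Ω ι : Type*} [MeasurableSpace Ω] {μ : Measure Ω}

open ProbabilityTheory

lemma integral_eq_zero_of_comp_eq_neg {σ : Ω → Ω} (hσ : MeasurePreserving σ μ μ) {f : Ω → ℝ}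
    (hf : Measurable f) (h : ∀ ω, f (σ ω) = -f ω) : ∫ ω, f ω ∂μ = 0 := by
  have h1 : ∫ ω, f ω ∂μ = ∫ ω, f (σ ω) ∂μ := by
    conv_lhs => rw [← hσ.map_eq]
    exact integral_map hσ.measurable.aemeasurable hf.aestronglyMeasurable
  simp_rw [h, integral_neg] at h1
  linarith

lemma integral_pow_mul_pow_of_indepFun {Y Z : Ω → ℝ} (hY : Measurable Y) (hZ : Measurable Z)
    (h : IndepFun Y Z μ) (a b : ℕ) :
    ∫ ω, Y ω ^ a * Z ω ^ b ∂μ = (∫ ω, Y ω ^ a ∂μ) * ∫ ω, Z ω ^ b ∂μ :=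
  (h.comp (measurable_id.pow_const a) (measurable_id.pow_const b)).integral_fun_mul_eq_mul_integral
    (hY.pow_const a).aestronglyMeasurable (hZ.pow_const b).aestronglyMeasurable

lemma indepFun_sum_sum_of_disjoint {X : ι → Ω → ℝ} (hm : ∀ i, Measurable (X i))
    (hI : iIndepFun X μ) {s t : Finset ι} (hst : Disjoint s t) :
    IndepFun (fun ω => ∑ i ∈ s, X i ω) (fun ω => ∑ i ∈ t, X i ω) μ := by
  have h := (hI.indepFun_finset s t hst hm).comp
    (φ := fun v => ∑ i, v i) (ψ := fun v => ∑ i, v i)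
    (Finset.measurable_sum _ fun i _ => measurable_pi_apply i)
    (Finset.measurable_sum _ fun i _ => measurable_pi_apply i)
  convert h using 1
  · ext ω
    exact (Finset.sum_coe_sort s fun i => X i ω).symm
  · ext ω
    exact (Finset.sum_coe_sort t fun i => X i ω).symm

variable [IsProbabilityMeasure μ]

lemma integrable_pow_mul_pow_of_bound {Y Z : Ω → ℝ} (hY : Measurable Y) (hZ : Measurable Z)
    {C : ℝ} (hYC : ∀ ω, |Y ω| ≤ C) (hZ1 : ∀ ω, |Z ω| ≤ 1) (a b : ℕ) :
    Integrable (fun ω => Y ω ^ a * Z ω ^ b) μ := by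
  refine Integrable.of_bound ((hY.pow_const a).mul (hZ.pow_const b)).aestronglyMeasurable (C ^ a)
    (Filter.Eventually.of_forall fun ω => ?_)
  rw [norm_mul, norm_pow, norm_pow, Real.norm_eq_abs, Real.norm_eq_abs]
  calc |Y ω| ^ a * |Z ω| ^ b ≤ C ^ a * 1 := by
        refine mul_le_mul (pow_le_pow_left₀ (abs_nonneg _) (hYC ω) a)
          (pow_le_one₀ (abs_nonneg _) (hZ1 ω)) (by positivity) ?_
        exact pow_nonneg ((abs_nonneg _).trans (hYC ω)) a
    _ = _ := mul_one _

/-- Moments of sums of independent, bounded random variables with vanishing odd moments. -/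
lemma moments_sum_of_iIndepFun {X : ι → Ω → ℝ} (hm : ∀ i, Measurable (X i)) (hI : iIndepFun X μ)
    (hb : ∀ i ω, |X i ω| ≤ 1) (h1 : ∀ i, ∫ ω, X i ω ∂μ = 0) (h3 : ∀ i, ∫ ω, X i ω ^ 3 ∂μ = 0)
    {c : ℝ} (h2 : ∀ i, c ≤ ∫ ω, X i ω ^ 2 ∂μ) (s : Finset ι) :
    ∫ ω, (∑ i ∈ s, X i ω) ∂μ = 0 ∧ c * s.card ≤ ∫ ω, (∑ i ∈ s, X i ω) ^ 2 ∂μ ∧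
      ∫ ω, (∑ i ∈ s, X i ω) ^ 2 ∂μ ≤ s.card ∧
      ∫ ω, (∑ i ∈ s, X i ω) ^ 4 ∂μ ≤ 3 * (s.card : ℝ) ^ 2 := by
  classical
  induction s using Finset.induction_on with
  | empty => simp
  | insert i s hi ih =>
    obtain ⟨ih1, ih2, ih3, ih4⟩ := ih
    set Y : Ω → ℝ := fun ω => ∑ j ∈ s, X j ω with hYdef
    have hY : Measurable Y := Finset.measurable_sum _ fun j _ => hm j
    have hYC : ∀ ω, |Y ω| ≤ s.card := fun ω =>
      (Finset.abs_sum_le_sum_abs _ _).trans ((Finset.sum_le_sum fun j _ => hb j ω).trans (by simp))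
    have hind : IndepFun Y (X i) μ := by
      have := hI.indepFun_finsetSum_of_notMem hm hi
      convert this using 1
      ext ω
      simp [hYdef]
    have key := integral_pow_mul_pow_of_indepFun hY (hm i) hind
    have hint := integrable_pow_mul_pow_of_bound (μ := μ) hY (hm i) hYC (hb i)
    have u2 : ∫ ω, X i ω ^ 2 ∂μ ≤ 1 := by
      calc ∫ ω, X i ω ^ 2 ∂μ ≤ ∫ _, (1 : ℝ) ∂μ := by
            refine integral_mono (by simpa using hint 0 2) (integrable_const _) fun ω => ?_
            exact (sq_le_one_iff_abs_le_one _).2 (hb i ω)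
        _ = 1 := by simp
    have u4 : ∫ ω, X i ω ^ 4 ∂μ ≤ 1 := by
      calc ∫ ω, X i ω ^ 4 ∂μ ≤ ∫ _, (1 : ℝ) ∂μ := by
            refine integral_mono (by simpa using hint 0 4) (integrable_const _) fun ω => ?_
            have := (sq_le_one_iff_abs_le_one _).2 (hb i ω)
            dsimp only
            nlinarith [sq_nonneg (X i ω)]
        _ = 1 := by simp
    have u2' : 0 ≤ ∫ ω, X i ω ^ 2 ∂μ := integral_nonneg fun _ => sq_nonneg _
    have e2 : ∫ ω, (∑ j ∈ insert i s, X j ω) ^ 2 ∂μ = ∫ ω, Y ω ^ 2 ∂μ + ∫ ω, X i ω ^ 2 ∂μ := by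
      have : ∀ ω, (∑ j ∈ insert i s, X j ω) ^ 2 =
          Y ω ^ 2 * X i ω ^ 0 + 2 * (Y ω ^ 1 * X i ω ^ 1) + Y ω ^ 0 * X i ω ^ 2 := by
        intro ω
        rw [Finset.sum_insert hi]
        simp only [hYdef]
        ring
      simp_rw [this]
      have i1 : Integrable (fun ω => Y ω ^ 2 * X i ω ^ 0 + 2 * (Y ω ^ 1 * X i ω ^ 1)) μ :=
        (hint 2 0).add ((hint 1 1).const_mul 2)
      rw [integral_add i1 (hint 0 2),
        integral_add (hint 2 0) ((hint 1 1).const_mul 2), integral_const_mul, key, key, key]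
      simp [h1]
    have e4 : ∫ ω, (∑ j ∈ insert i s, X j ω) ^ 4 ∂μ =
        ∫ ω, Y ω ^ 4 ∂μ + 6 * ((∫ ω, Y ω ^ 2 ∂μ) * ∫ ω, X i ω ^ 2 ∂μ) + ∫ ω, X i ω ^ 4 ∂μ := by
      have : ∀ ω, (∑ j ∈ insert i s, X j ω) ^ 4 =
          Y ω ^ 4 * X i ω ^ 0 + 4 * (Y ω ^ 3 * X i ω ^ 1) + 6 * (Y ω ^ 2 * X i ω ^ 2) +
          4 * (Y ω ^ 1 * X i ω ^ 3) + Y ω ^ 0 * X i ω ^ 4 := by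
        intro ω
        rw [Finset.sum_insert hi]
        simp only [hYdef]
        ring
      simp_rw [this]
      have i1 : Integrable (fun ω => Y ω ^ 4 * X i ω ^ 0 + 4 * (Y ω ^ 3 * X i ω ^ 1)) μ :=
        (hint 4 0).add ((hint 3 1).const_mul 4)
      have i2 : Integrable (fun ω => Y ω ^ 4 * X i ω ^ 0 + 4 * (Y ω ^ 3 * X i ω ^ 1) +
          6 * (Y ω ^ 2 * X i ω ^ 2)) μ := i1.add ((hint 2 2).const_mul 6)
      have i3 : Integrable (fun ω => Y ω ^ 4 * X i ω ^ 0 + 4 * (Y ω ^ 3 * X i ω ^ 1) +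
          6 * (Y ω ^ 2 * X i ω ^ 2) + 4 * (Y ω ^ 1 * X i ω ^ 3)) μ := i2.add ((hint 1 3).const_mul 4)
      rw [integral_add i3 (hint 0 4), integral_add i2 ((hint 1 3).const_mul 4),
        integral_add i1 ((hint 2 2).const_mul 6), integral_add (hint 4 0) ((hint 3 1).const_mul 4),
        integral_const_mul, integral_const_mul, integral_const_mul, key, key, key, key, key]
      simp [h1, h3]
    have hn : (0 : ℝ) ≤ s.card := Nat.cast_nonneg _
    refine ⟨?_, ?_, ?_, ?_⟩
    · simp_rw [Finset.sum_insert hi]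
      rw [integral_add (by simpa using hint 0 1) (by simpa using hint 1 0), h1, ih1, add_zero]
    · rw [e2, Finset.card_insert_of_notMem hi]
      push_cast
      have := h2 i
      linarith
    · rw [e2, Finset.card_insert_of_notMem hi]
      push_cast
      linarith
    · rw [e4, Finset.card_insert_of_notMem hi]
      push_cast
      -- The induction closes because `3n² + 6n + 1 ≤ 3(n + 1)²`.
      have : (∫ ω, Y ω ^ 2 ∂μ) * ∫ ω, X i ω ^ 2 ∂μ ≤ s.card * 1 :=
        mul_le_mul ih3 u2 u2' hn
      nlinarith

/-- A Paley–Zygmund estimate for symmetric sums. -/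
lemma measureReal_sum_ge_sqrt {X : ι → Ω → ℝ} (hm : ∀ i, Measurable (X i)) (hI : iIndepFun X μ)
    (hb : ∀ i ω, |X i ω| ≤ 1) {σ : Ω → Ω} (hσ : MeasurePreserving σ μ μ)
    (hX : ∀ i ω, X i (σ ω) = -X i ω) (h2 : ∀ i, 1 / 4 ≤ ∫ ω, X i ω ^ 2 ∂μ) {s : Finset ι}
    (hs : s.Nonempty) :
    1 / 384 ≤ μ.real {ω | Real.sqrt (s.card / 8) ≤ ∑ i ∈ s, X i ω} := by
  have hn : (0 : ℝ) < s.card := by exact_mod_cast hs.card_pos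
  obtain ⟨-, m2, -, m4⟩ := moments_sum_of_iIndepFun hm hI hb
    (fun i => integral_eq_zero_of_comp_eq_neg hσ (hm i) (hX i))
    (fun i => integral_eq_zero_of_comp_eq_neg hσ ((hm i).pow_const 3)
      fun ω => by rw [hX]; ring) h2 s
  set Y : Ω → ℝ := fun ω => ∑ j ∈ s, X j ω with hYdef
  have hY : Measurable Y := Finset.measurable_sum _ fun j _ => hm j
  have hYC : ∀ ω, |Y ω| ≤ s.card := fun ω =>
    (Finset.abs_sum_le_sum_abs _ _).trans ((Finset.sum_le_sum fun j _ => hb j ω).trans (by simp))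
  have hint : ∀ a, Integrable (fun ω => Y ω ^ a) μ := fun a => by
    simpa using integrable_pow_mul_pow_of_bound (μ := μ) (Z := fun _ => 0) hY measurable_const hYC
      (by simp) a 0
  set A : Set Ω := {ω | (s.card : ℝ) / 8 ≤ Y ω ^ 2} with hAdef
  have hA : MeasurableSet A := measurableSet_le measurable_const (hY.pow_const 2)
  -- On `A` this is `(Y² - 24n)² ≥ 0`, with `n = s.card`. Integrating gives `n/4 ≤ n/8 + n/16 + 12 n
  -- μ(A)`, hence `μ(A) ≥ 1/192`.
  have hpt : ∀ ω, Y ω ^ 2 ≤ s.card / 8 + (48 * s.card : ℝ)⁻¹ * Y ω ^ 4 +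
      A.indicator (fun _ => (12 * s.card : ℝ)) ω := by
    intro ω
    by_cases h : ω ∈ A
    · rw [Set.indicator_of_mem h]
      have : Y ω ^ 2 ≤ (48 * s.card : ℝ)⁻¹ * Y ω ^ 4 + 12 * s.card := by
        rw [← sub_nonneg]
        have e : (48 * s.card : ℝ)⁻¹ * Y ω ^ 4 + 12 * s.card - Y ω ^ 2 =
            (48 * s.card : ℝ)⁻¹ * (Y ω ^ 2 - 24 * s.card) ^ 2 := by
          field_simp
          ring
        rw [e]
        positivity
      linarith
    · rw [Set.indicator_of_notMem h]
      have h' : Y ω ^ 2 < s.card / 8 := not_le.1 h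
      have : 0 ≤ (48 * s.card : ℝ)⁻¹ * Y ω ^ 4 := by positivity
      linarith
  have hAi : Integrable (A.indicator fun _ => (12 * s.card : ℝ)) μ :=
    (integrable_const _).indicator hA
  have hi1 : Integrable (fun ω => (s.card : ℝ) / 8 + (48 * s.card : ℝ)⁻¹ * Y ω ^ 4) μ :=
    (integrable_const _).add ((hint 4).const_mul _)
  have hle := integral_mono (hint 2) (hi1.add hAi) hpt
  simp only [Pi.add_apply] at hle
  rw [integral_add hi1 hAi, integral_add (integrable_const _) ((hint 4).const_mul _),
    integral_const_mul, integral_indicator_const _ hA] at hle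
  simp only [integral_const, probReal_univ, smul_eq_mul, one_mul] at hle
  have h4 : (48 * s.card : ℝ)⁻¹ * ∫ ω, Y ω ^ 4 ∂μ ≤ s.card / 16 := by
    calc _ ≤ (48 * s.card : ℝ)⁻¹ * (3 * (s.card : ℝ) ^ 2) := by gcongr
      _ = _ := by field_simp; norm_num
  have hAge : 1 / 192 ≤ μ.real A := by
    have : (s.card : ℝ) * (1 / 16) ≤ s.card * (12 * μ.real A) := by linarith
    have := le_of_mul_le_mul_left this hn
    linarith
  set B : Set Ω := {ω | Real.sqrt (s.card / 8) ≤ Y ω} with hB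
  have hBm : MeasurableSet B := measurableSet_le measurable_const hY
  -- The sign-reversing `σ` makes both tails equally likely, which halves `1/192` to `1/384`.
  have hAB : A ⊆ B ∪ σ ⁻¹' B := by
    intro ω h
    have h' : Real.sqrt (s.card / 8) ≤ |Y ω| := Real.sqrt_le_iff.2
      ⟨abs_nonneg _, by rw [sq_abs]; exact h⟩
    rcases le_abs.1 h' with h'' | h''
    · exact Or.inl h''
    · refine Or.inr ?_
      change Real.sqrt (s.card / 8) ≤ Y (σ ω)
      rw [hYdef]
      simpa [hX, hYdef] using h''
  have := (measureReal_mono (μ := μ) hAB).trans (measureReal_union_le B (σ ⁻¹' B))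
  have hpre : μ.real (σ ⁻¹' B) = μ.real B := by
    rw [measureReal_def, hσ.measure_preimage hBm.nullMeasurableSet, measureReal_def]
  rw [hpre] at this
  linarith

/-- Two halves of `s` are independent, and the sum is large when both halves are. The threshold
doubles with the size, so it outgrows the square root of the size, at the cost of squaring the
probability. -/
lemma measureReal_sum_ge_of_doubling {X : ι → Ω → ℝ} (hm : ∀ i, Measurable (X i))
    (hI : iIndepFun X μ) {n : ℕ} {a p : ℝ} (hp : 0 ≤ p)
    (h : ∀ s : Finset ι, s.card = n → p ≤ μ.real {ω | a ≤ ∑ i ∈ s, X i ω}) (b : ℕ)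
    (s : Finset ι) (hs : s.card = 2 ^ b * n) :
    p ^ 2 ^ b ≤ μ.real {ω | 2 ^ b * a ≤ ∑ i ∈ s, X i ω} := by
  classical
  induction b generalizing s with
  | zero => simpa using h s (by simpa using hs)
  | succ b ih =>
    obtain ⟨t, hts, htc⟩ := Finset.exists_subset_card_eq (s := s) (n := 2 ^ b * n)
      (by rw [hs, pow_succ, mul_assoc]; exact Nat.mul_le_mul_left _ (by omega))
    have hc : (s \ t).card = 2 ^ b * n := by
      rw [Finset.card_sdiff_of_subset hts, htc, hs, pow_succ]
      have : 2 ^ b * 2 * n = 2 ^ b * n + 2 ^ b * n := by ring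
      omega
    have hind := indepFun_sum_sum_of_disjoint hm hI (Finset.disjoint_sdiff (s := t) (t := s))
    have := hind.measure_inter_preimage_eq_mul (Set.Ici (2 ^ b * a)) (Set.Ici (2 ^ b * a))
      measurableSet_Ici measurableSet_Ici
    have hreal := congrArg ENNReal.toReal this
    rw [ENNReal.toReal_mul] at hreal
    have h1 := ih t htc
    have h2 := ih (s \ t) hc
    calc p ^ 2 ^ (b + 1) = p ^ 2 ^ b * p ^ 2 ^ b := by rw [← pow_add]; congr 1; ring
      _ ≤ μ.real {ω | 2 ^ b * a ≤ ∑ i ∈ t, X i ω} * μ.real {ω | 2 ^ b * a ≤ ∑ i ∈ s \ t, X i ω} :=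
        mul_le_mul h1 h2 (by positivity) measureReal_nonneg
      _ = _ := hreal.symm
      _ ≤ _ := by
        refine measureReal_mono (μ := μ) ?_
        rintro ω ⟨hω1, hω2⟩
        simp only [Set.mem_preimage, Set.mem_Ici] at hω1 hω2
        change 2 ^ (b + 1) * a ≤ ∑ i ∈ s, X i ω
        rw [← Finset.sum_sdiff hts, pow_succ]
        linarith

/-- Sums of `2 ^ b * n` variables exceed a large multiple of the square root of their number, while
staying below a given level, with probability bounded below. -/
lemma measureReal_sum_mem_Icc_ge {X : ι → Ω → ℝ} (hm : ∀ i, Measurable (X i)) (hI : iIndepFun X μ)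
    (hb : ∀ i ω, |X i ω| ≤ 1) {σ : Ω → Ω} (hσ : MeasurePreserving σ μ μ)
    (hX : ∀ i ω, X i (σ ω) = -X i ω) (h2 : ∀ i, 1 / 4 ≤ ∫ ω, X i ω ^ 2 ∂μ) {n : ℕ} (hn : 0 < n)
    (b : ℕ) {y : ℝ} (hy : 0 < y) (s : Finset ι) (hs : s.card = 2 ^ b * n) :
    (1 / 384 : ℝ) ^ 2 ^ b - s.card / y ^ 2 ≤
      μ.real {ω | 2 ^ b * Real.sqrt (n / 8) ≤ ∑ i ∈ s, X i ω ∧ ∑ i ∈ s, X i ω ≤ y} := by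
  have hlow := measureReal_sum_ge_of_doubling (μ := μ) hm hI (n := n) (a := Real.sqrt (n / 8))
    (p := 1 / 384) (by norm_num) (fun s hs => by
      have := measureReal_sum_ge_sqrt hm hI hb hσ hX h2 (s := s)
        (Finset.card_pos.1 (by omega))
      rwa [hs] at this) b s hs
  obtain ⟨-, -, m2, -⟩ := moments_sum_of_iIndepFun hm hI hb
    (fun i => integral_eq_zero_of_comp_eq_neg hσ (hm i) (hX i))
    (fun i => integral_eq_zero_of_comp_eq_neg hσ ((hm i).pow_const 3)
      fun ω => by rw [hX]; ring) h2 s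
  set Y : Ω → ℝ := fun ω => ∑ j ∈ s, X j ω with hYdef
  have hY : Measurable Y := Finset.measurable_sum _ fun j _ => hm j
  have hYC : ∀ ω, |Y ω| ≤ s.card := fun ω =>
    (Finset.abs_sum_le_sum_abs _ _).trans ((Finset.sum_le_sum fun j _ => hb j ω).trans (by simp))
  have hint : Integrable (fun ω => Y ω ^ 2) μ := by
    simpa using integrable_pow_mul_pow_of_bound (μ := μ) (Z := fun _ => 0) hY measurable_const hYC
      (by simp) 2 0
  -- Chebyshev's inequality controls the event that the sum exceeds `y`.
  have hch := mul_meas_ge_le_integral_of_nonneg (Filter.Eventually.of_forall fun ω => sq_nonneg _)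
    hint (y ^ 2)
  have hch' : μ.real {ω | y ^ 2 ≤ Y ω ^ 2} ≤ s.card / y ^ 2 := by
    rw [le_div_iff₀ (by positivity)]
    linarith
  have hsub : {ω | 2 ^ b * Real.sqrt (n / 8) ≤ Y ω} ⊆
      {ω | 2 ^ b * Real.sqrt (n / 8) ≤ Y ω ∧ Y ω ≤ y} ∪ {ω | y ^ 2 ≤ Y ω ^ 2} := by
    intro ω h
    by_cases h' : Y ω ≤ y
    · exact Or.inl ⟨h, h'⟩
    · right
      have : y < Y ω := not_le.1 h'
      change y ^ 2 ≤ Y ω ^ 2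
      gcongr
  have := (measureReal_mono (μ := μ) hsub).trans (measureReal_union_le _ _)
  linarith

/-- Events that depend on disjoint blocks of independent `σ`-algebras are independent. -/
lemma measure_biInter_eq_prod_of_iIndep {m : ι → MeasurableSpace Ω}
    (hle : ∀ i, m i ≤ ‹MeasurableSpace Ω›) (hI : iIndep m μ) {s : ℕ → Set ι}
    (hs : Pairwise fun k l => Disjoint (s k) (s l)) {E : ℕ → Set Ω}
    (hE : ∀ k, MeasurableSet[⨆ i ∈ s k, m i] (E k)) (F : Finset ℕ) :
    μ (⋂ k ∈ F, E k) = ∏ k ∈ F, μ (E k) := by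
  induction F using Finset.induction_on with
  | empty => simp
  | insert a F ha ih =>
    rw [Finset.set_biInter_insert, Finset.prod_insert ha, ← ih]
    have hd : Disjoint (s a) (⋃ k ∈ F, s k) := by
      simp only [Set.disjoint_iUnion_right]
      intro k hk
      exact hs fun h => ha (h ▸ hk)
    refine (Indep_iff _ _ μ).1 (indep_iSup_of_disjoint hle hI hd) _ _ (hE a) ?_
    refine MeasurableSet.biInter F.countable_toSet fun k hk => ?_
    refine (iSup₂_le fun i hi => ?_ : (⨆ i ∈ s k, m i) ≤ ⨆ i ∈ ⋃ k ∈ F, s k, m i) _ (hE k)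
    exact le_iSup₂_of_le i (Set.mem_biUnion hk hi) le_rfl

end BoundedSums

/-! ### The argument of a Riesz product as a random walk -/

/-- The Haar probability measure of the torus. -/
noncomputable abbrev torusMeasure (J : ℕ) : Measure (Fin J → UnitAddCircle) :=
  Measure.pi fun _ => AddCircle.haarAddCircle

lemma continuous_circleCos : Continuous circleCos :=
  Complex.continuous_re.comp (fourier 1).continuous

lemma abs_circleCos_le (t : UnitAddCircle) : |circleCos t| ≤ 1 := by
  refine (Complex.abs_re_le_norm _).trans ?_
  rw [fourier_apply, Circle.norm_coe]

lemma circleCos_half_add (t : UnitAddCircle) :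
    circleCos (((1 / 2 : ℝ) : UnitAddCircle) + t) = -circleCos t := by
  have := fourier_add_half_inv_index (T := (1 : ℝ)) (n := 1) one_ne_zero one_pos t
  rw [add_comm]
  unfold circleCos
  rw [Int.cast_one, div_one] at this
  rw [this, Complex.neg_re]

lemma integral_circleCos_sq :
    ∫ t, circleCos t ^ 2 ∂(AddCircle.haarAddCircle (T := (1 : ℝ))) = 1 / 2 := by
  have hi : ∀ m : ℤ, Integrable (fun t : UnitAddCircle => (fourier m t : ℂ))
      AddCircle.haarAddCircle := fun m =>
    (fourier m).continuous.integrable_of_hasCompactSupport (HasCompactSupport.of_compactSpace _)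
  have h : ∀ t : UnitAddCircle, circleCos t ^ 2 = 1 / 2 + 1 / 2 * (fourier 2 t : ℂ).re := by
    intro t
    have h1 : (fourier 2 t : ℂ) = fourier 1 t * fourier 1 t := by
      rw [← fourier_add]
      norm_num
    have h2 : ‖(fourier 1 t : ℂ)‖ = 1 := by rw [fourier_apply, Circle.norm_coe]
    have h3 : (fourier 1 t : ℂ).re * (fourier 1 t : ℂ).re +
        (fourier 1 t : ℂ).im * (fourier 1 t : ℂ).im = 1 := by
      rw [← Complex.normSq_apply, Complex.normSq_eq_norm_sq, h2]
      norm_num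
    rw [h1, Complex.mul_re, circleCos]
    linarith
  have hre : ∫ t, (fourier 2 t : ℂ).re ∂(AddCircle.haarAddCircle (T := (1 : ℝ))) = 0 := by
    have := integral_re (𝕜 := ℂ) (hi 2)
    simp only [RCLike.re_to_complex] at this
    rw [this, integral_fourier_eq]
    simp
  simp_rw [h]
  have hi2 : Integrable (fun t : UnitAddCircle => 1 / 2 * (fourier 2 t : ℂ).re)
      AddCircle.haarAddCircle := (hi 2).re.const_mul _
  rw [integral_add (integrable_const _) hi2, integral_const_mul, hre]
  simp

/-- The normalised argument of a factor of the Riesz product. -/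
noncomputable def rieszArg {J : ℕ} (δ : ℝ) (i : Fin J) (θ : Fin J → UnitAddCircle) : ℝ :=
  δ⁻¹ * Real.arctan (δ * circleCos (θ i))

lemma abs_arctan_le_abs (y : ℝ) : |Real.arctan y| ≤ |y| := by
  wlog h : 0 ≤ y generalizing y
  · simpa [Real.arctan_neg] using this (-y) (by linarith)
  rw [abs_of_nonneg h, abs_of_nonneg (Real.arctan_nonneg.2 h)]
  simpa using Real.le_tan (Real.arctan_nonneg.2 h) (Real.arctan_lt_pi_div_two y)

/-- Compare with `sin² (arctan y) = y² / (1 + y²)`, whose denominator is at most `2`. -/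
lemma sq_div_two_le_arctan_sq {y : ℝ} (hy : |y| ≤ 1) : y ^ 2 / 2 ≤ Real.arctan y ^ 2 := by
  have hy2 : y ^ 2 ≤ 1 := (sq_le_one_iff_abs_le_one y).2 hy
  have h1 : Real.sin (Real.arctan y) ^ 2 ≤ Real.arctan y ^ 2 := sq_le_sq.2 Real.abs_sin_le_abs
  have h2 : Real.sin (Real.arctan y) ^ 2 = y ^ 2 / (1 + y ^ 2) := by
    rw [Real.sin_arctan, div_pow, Real.sq_sqrt (by positivity)]
  refine le_trans ?_ h1
  rw [h2]
  gcongr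
  linarith

section Arg

variable {J : ℕ} {δ : ℝ}

lemma measurable_rieszArg (i : Fin J) : Measurable (rieszArg δ i) :=
  (Real.measurable_arctan.comp
    ((continuous_circleCos.measurable.comp (measurable_pi_apply i)).const_mul δ)).const_mul _

lemma iIndepFun_rieszArg :
    ProbabilityTheory.iIndepFun (fun i : Fin J => rieszArg δ i) (torusMeasure J) := by
  have := ProbabilityTheory.iIndepFun_pi
    (μ := fun _ : Fin J => AddCircle.haarAddCircle (T := (1 : ℝ)))
    (X := fun (_ : Fin J) t => δ⁻¹ * Real.arctan (δ * circleCos t))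
    (fun i => ((Real.measurable_arctan.comp
      (continuous_circleCos.measurable.const_mul δ)).const_mul _).aemeasurable)
  exact this

lemma abs_rieszArg_le (hδ : 0 < δ) (i : Fin J) (θ : Fin J → UnitAddCircle) :
    |rieszArg δ i θ| ≤ 1 := by
  rw [rieszArg, abs_mul, abs_inv, abs_of_pos hδ, inv_mul_le_iff₀ hδ, mul_one]
  refine (abs_arctan_le_abs _).trans ?_
  rw [abs_mul, abs_of_pos hδ]
  exact mul_le_of_le_one_right hδ.le (abs_circleCos_le _)

lemma rieszArg_half_add (i : Fin J) (θ : Fin J → UnitAddCircle) :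
    rieszArg δ i ((fun _ => ((1 / 2 : ℝ) : UnitAddCircle)) + θ) = -rieszArg δ i θ := by
  simp only [rieszArg, Pi.add_apply, circleCos_half_add, mul_neg, Real.arctan_neg]

lemma integral_rieszArg_sq_ge (hδ : 0 < δ) (hδ1 : δ ≤ 1) (i : Fin J) :
    1 / 4 ≤ ∫ θ, rieszArg δ i θ ^ 2 ∂torusMeasure J := by
  have hpt : ∀ θ : Fin J → UnitAddCircle, 1 / 2 * circleCos (θ i) ^ 2 ≤ rieszArg δ i θ ^ 2 := by
    intro θ
    have h := sq_div_two_le_arctan_sq (y := δ * circleCos (θ i)) (by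
      rw [abs_mul, abs_of_pos hδ]
      exact mul_le_one₀ hδ1 (abs_nonneg _) (abs_circleCos_le _))
    rw [rieszArg, mul_pow, inv_pow, ← div_eq_inv_mul, le_div_iff₀ (by positivity)]
    calc _ = (δ * circleCos (θ i)) ^ 2 / 2 := by ring
      _ ≤ _ := h
  have hc : ∫ θ : Fin J → UnitAddCircle, circleCos (θ i) ^ 2 ∂torusMeasure J = 1 / 2 := by
    rw [← integral_circleCos_sq,
      ← (measurePreserving_eval (fun _ : Fin J => AddCircle.haarAddCircle (T := (1 : ℝ))) i).map_eq,
      integral_map (measurable_pi_apply i).aemeasurable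
        (continuous_circleCos.pow 2).aestronglyMeasurable]
  have hb1 : Integrable (fun θ : Fin J → UnitAddCircle => circleCos (θ i) ^ 2) (torusMeasure J) := by
    refine Integrable.of_bound ((continuous_circleCos.comp
      (continuous_apply i)).pow 2).aestronglyMeasurable 1 (Filter.Eventually.of_forall fun θ => ?_)
    rw [Real.norm_eq_abs, abs_of_nonneg (sq_nonneg _)]
    exact (sq_le_one_iff_abs_le_one _).2 (abs_circleCos_le _)
  have hb2 : Integrable (fun θ : Fin J → UnitAddCircle => rieszArg δ i θ ^ 2) (torusMeasure J) := by
    refine Integrable.of_bound ((measurable_rieszArg i).pow_const 2).aestronglyMeasurable 1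
      (Filter.Eventually.of_forall fun θ => ?_)
    rw [Real.norm_eq_abs, abs_of_nonneg (sq_nonneg _)]
    exact (sq_le_one_iff_abs_le_one _).2 (abs_rieszArg_le hδ _ _)
  have := integral_mono (hb1.const_mul (1 / 2)) hb2 hpt
  rw [integral_const_mul, hc] at this
  linarith

lemma one_add_mul_I_eq (y : ℝ) : 1 + (y : ℂ) * Complex.I =
    ((Real.cos (Real.arctan y))⁻¹ : ℝ) * Complex.exp ((Real.arctan y : ℝ) * Complex.I) := by
  have hc := (Real.cos_arctan_pos y).ne'
  have hs : Real.sin (Real.arctan y) = y * Real.cos (Real.arctan y) := by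
    rw [Real.sin_arctan, Real.cos_arctan]
    ring
  rw [Complex.exp_mul_I, ← Complex.ofReal_cos, ← Complex.ofReal_sin, hs]
  have : ((Real.cos (Real.arctan y) : ℝ) : ℂ) ≠ 0 := by exact_mod_cast hc
  push_cast
  push_cast at this
  field_simp

/-- Arguments of the factors add up: the phase is `δ` times a sum of independent symmetric
variables. -/
lemma rieszProd_eq_exp (hδ : δ ≠ 0) (s : Finset (Fin J)) (θ : Fin J → UnitAddCircle) :
    rieszProd δ s θ = ((∏ i ∈ s, (Real.cos (Real.arctan (δ * circleCos (θ i))))⁻¹ : ℝ) : ℂ) *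
      Complex.exp ((δ * ∑ i ∈ s, rieszArg δ i θ : ℝ) * Complex.I) := by
  have : ((δ * ∑ i ∈ s, rieszArg δ i θ : ℝ) : ℂ) * Complex.I =
      ∑ i ∈ s, ((Real.arctan (δ * circleCos (θ i)) : ℝ) : ℂ) * Complex.I := by
    rw [← Finset.sum_mul, ← Complex.ofReal_sum, Finset.mul_sum]
    congr 2
    refine Finset.sum_congr rfl fun i _ => ?_
    rw [rieszArg, mul_inv_cancel_left₀ hδ]
  rw [this, Complex.exp_sum, Complex.ofReal_prod, ← Finset.prod_mul_distrib, rieszProd]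
  exact Finset.prod_congr rfl fun i _ => one_add_mul_I_eq _

/-- Every factor has real part `1`. Hence multiplying an increment by a further partial product
never shrinks it. -/
lemma one_le_norm_rieszProd (s : Finset (Fin J)) (θ : Fin J → UnitAddCircle) :
    1 ≤ ‖rieszProd δ s θ‖ := by
  rw [rieszProd, norm_prod]
  refine Finset.one_le_prod fun i _ => ?_
  refine le_trans ?_ (Complex.abs_re_le_norm _)
  simp

/-- The imaginary part is a factor at least `1` times `sin (δ S)`. The cap `S ≤ δ⁻¹` keeps `δ S` in
`[0, 1]`, where `sin x ≥ 2x/π ≥ x/2`. -/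
lemma half_mul_sum_rieszArg_le_norm (hδ : 0 < δ) (s : Finset (Fin J)) (θ : Fin J → UnitAddCircle)
    (h0 : 0 ≤ ∑ i ∈ s, rieszArg δ i θ) (h1 : ∑ i ∈ s, rieszArg δ i θ ≤ δ⁻¹) :
    δ * (∑ i ∈ s, rieszArg δ i θ) / 2 ≤ ‖rieszProd δ s θ - 1‖ := by
  set S := ∑ i ∈ s, rieszArg δ i θ
  have hS0 : 0 ≤ δ * S := by positivity
  have hS1 : δ * S ≤ 1 := by
    calc δ * S ≤ δ * δ⁻¹ := by gcongr
      _ = 1 := mul_inv_cancel₀ hδ.ne'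
  have hsin : δ * S / 2 ≤ Real.sin (δ * S) := by
    refine le_trans ?_ (Real.mul_le_sin hS0 (by linarith [Real.pi_gt_three]))
    rw [div_mul_eq_mul_div, div_le_div_iff₀ two_pos Real.pi_pos]
    nlinarith [Real.pi_le_four]
  have hR : 1 ≤ ∏ i ∈ s, (Real.cos (Real.arctan (δ * circleCos (θ i))))⁻¹ :=
    Finset.one_le_prod fun i _ => (one_le_inv₀ (Real.cos_arctan_pos _)).2 (Real.cos_le_one _)
  have him : (rieszProd δ s θ - 1).im =
      (∏ i ∈ s, (Real.cos (Real.arctan (δ * circleCos (θ i))))⁻¹) * Real.sin (δ * S) := by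
    rw [rieszProd_eq_exp hδ.ne', Complex.sub_im, Complex.im_ofReal_mul, Complex.exp_ofReal_mul_I_im, Complex.one_im, sub_zero]
  refine le_trans ?_ (Complex.abs_im_le_norm _)
  rw [him]
  refine le_trans ?_ (le_abs_self _)
  calc δ * S / 2 ≤ 1 * Real.sin (δ * S) := by rw [one_mul]; exact hsin
    _ ≤ _ := mul_le_mul_of_nonneg_right hR (by linarith)

/-- The level `y = δ⁻¹` caps the phase, and `hsδ` makes the Chebyshev loss at most half of the main
probability. The factor `32` is `8 · 2²`, from `√(n/8)` and the division by two in the phase bound.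
-/
lemma measureReal_norm_rieszProd_sub_one_ge (hδ : 0 < δ) (hδ1 : δ ≤ 1) {n b : ℕ} (hn : 0 < n)
    (s : Finset (Fin J)) (hs : s.card = 2 ^ b * n)
    (hsδ : s.card * δ ^ 2 ≤ (1 / 384 : ℝ) ^ 2 ^ b / 2) :
    (1 / 384 : ℝ) ^ 2 ^ b / 2 ≤ (torusMeasure J).real
      {θ | 2 ^ b * δ ^ 2 * s.card ≤ 32 * ‖rieszProd δ s θ - 1‖ ^ 2} := by
  have h := measureReal_sum_mem_Icc_ge (μ := torusMeasure J) (measurable_rieszArg (J := J) (δ := δ))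
    iIndepFun_rieszArg (abs_rieszArg_le hδ)
    (measurePreserving_add_left (torusMeasure J) fun _ => ((1 / 2 : ℝ) : UnitAddCircle))
    rieszArg_half_add (integral_rieszArg_sq_ge hδ hδ1) hn b (inv_pos.2 hδ) s hs
  rw [inv_pow, div_inv_eq_mul] at h
  have h' : (1 / 384 : ℝ) ^ 2 ^ b / 2 ≤ _ := le_trans (by linarith) h
  refine le_trans h' (measureReal_mono ?_)
  rintro θ ⟨h1, h2⟩
  have h0 : 0 ≤ 2 ^ b * Real.sqrt ((n : ℝ) / 8) := by positivity
  have h3 := half_mul_sum_rieszArg_le_norm hδ s θ (h0.trans h1) h2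
  change 2 ^ b * δ ^ 2 * (s.card : ℝ) ≤ 32 * ‖rieszProd δ s θ - 1‖ ^ 2
  have h4 : δ * (2 ^ b * Real.sqrt ((n : ℝ) / 8)) / 2 ≤ ‖rieszProd δ s θ - 1‖ := by
    refine le_trans ?_ h3
    gcongr
  have h5 := pow_le_pow_left₀ (by positivity) h4 2
  rw [div_pow, mul_pow, mul_pow, Real.sq_sqrt (by positivity)] at h5
  rw [hs]
  push_cast
  calc (2 : ℝ) ^ b * δ ^ 2 * (2 ^ b * n) = 32 * (δ ^ 2 * ((2 ^ b) ^ 2 * (n / 8)) / 2 ^ 2) := by ring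
    _ ≤ _ := by gcongr

end Arg

/-! ### Dyadic blocks and the covering of most points -/

/-- The dyadic block `[a 2 ^ k, (a + 1) 2 ^ k)` of `{0, …, 2 ^ m - 1}`. -/
def dyadicBlock (m k a : ℕ) : Finset (Fin (2 ^ m)) :=
  Finset.univ.filter fun i => i.val / 2 ^ k = a

lemma div_two_pow_add_one_mul_le {m k t : ℕ} (hk : k ≤ m) (ht : t < 2 ^ m) :
    (t / 2 ^ k + 1) * 2 ^ k ≤ 2 ^ m := by
  have h : 2 ^ m = 2 ^ (m - k) * 2 ^ k := by rw [← pow_add, Nat.sub_add_cancel hk]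
  rw [h]
  refine Nat.mul_le_mul_right _ ?_
  rw [Nat.succ_le_iff, Nat.div_lt_iff_lt_mul (by positivity), ← h]
  exact ht

lemma card_dyadicBlock {m k t : ℕ} (hk : k ≤ m) (ht : t < 2 ^ m) :
    (dyadicBlock m k (t / 2 ^ k)).card = 2 ^ k := by
  have hle := div_two_pow_add_one_mul_le hk ht
  generalize t / 2 ^ k = a at *
  have : (dyadicBlock m k a).map Fin.valEmbedding = Finset.Ico (a * 2 ^ k) ((a + 1) * 2 ^ k) := by
    ext x
    simp only [dyadicBlock, Finset.mem_map, Finset.mem_filter, Finset.mem_univ, true_and,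
      Fin.valEmbedding_apply, Finset.mem_Ico]
    have e : ∀ y : ℕ, y / 2 ^ k = a ↔ a * 2 ^ k ≤ y ∧ y < (a + 1) * 2 ^ k := by
      intro y
      rw [Nat.div_eq_iff (by positivity), add_mul]
      have : 0 < 2 ^ k := by positivity
      omega
    constructor
    · rintro ⟨i, hi, rfl⟩
      exact (e _).1 hi
    · intro hx
      exact ⟨⟨x, by omega⟩, (e x).2 hx, rfl⟩
  rw [← Finset.card_map Fin.valEmbedding, this, Nat.card_Ico, add_mul]
  omega

lemma dyadicBlock_subset_succ (m k t : ℕ) :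
    dyadicBlock m k (t / 2 ^ k) ⊆ dyadicBlock m (k + 1) (t / 2 ^ (k + 1)) := by
  intro i hi
  simp only [dyadicBlock, Finset.mem_filter, Finset.mem_univ, true_and] at hi ⊢
  rw [pow_succ, ← Nat.div_div_eq_div_mul, ← Nat.div_div_eq_div_mul, hi]

lemma dyadicBlock_subset_of_le (m t : ℕ) {k l : ℕ} (h : k ≤ l) :
    dyadicBlock m k (t / 2 ^ k) ⊆ dyadicBlock m l (t / 2 ^ l) :=
  monotone_nat_of_le_succ (f := fun k => dyadicBlock m k (t / 2 ^ k))
    (fun k => dyadicBlock_subset_succ m k t) h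

/-- The sibling of the dyadic block of size `2 ^ k` that contains `t`. -/
def dyadicSibling (m k t : ℕ) : Finset (Fin (2 ^ m)) :=
  dyadicBlock m (k + 1) (t / 2 ^ (k + 1)) \ dyadicBlock m k (t / 2 ^ k)

lemma card_dyadicSibling {m k t : ℕ} (hk : k + 1 ≤ m) (ht : t < 2 ^ m) :
    (dyadicSibling m k t).card = 2 ^ k := by
  rw [dyadicSibling, Finset.card_sdiff_of_subset (dyadicBlock_subset_succ m k t),
    card_dyadicBlock hk ht, card_dyadicBlock (by omega) ht, pow_succ]
  omega

/-- A sibling lies in the next larger block around `t`, and all siblings at larger scales avoid that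
block. The nested blocks themselves are not disjoint, so independence is sought through siblings. -/
lemma pairwise_disjoint_dyadicSibling (m t : ℕ) :
    Pairwise fun k l => Disjoint (dyadicSibling m k t : Set (Fin (2 ^ m)))
      (dyadicSibling m l t) := by
  have h : ∀ k l, k < l → Disjoint (dyadicSibling m k t : Set (Fin (2 ^ m)))
      (dyadicSibling m l t) := by
    intro k l hkl
    rw [Finset.disjoint_coe]
    refine Finset.disjoint_left.2 fun i hi hi' => ?_
    exact (Finset.mem_sdiff.1 hi').2 (dyadicBlock_subset_of_le m t hkl (Finset.mem_sdiff.1 hi).1)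
  intro k l hkl
  rcases lt_or_gt_of_ne hkl with h' | h'
  exacts [h k l h', (h l k h').symm]

lemma measurable_rieszProd {Ω : Type*} [MeasurableSpace Ω] {J : ℕ} (δ : ℝ) (s : Finset (Fin J))
    {g : Ω → Fin J → UnitAddCircle} (hg : ∀ i ∈ s, Measurable fun ω => g ω i) :
    Measurable fun ω => rieszProd δ s (g ω) := by
  unfold rieszProd
  refine Finset.measurable_prod _ fun i hi => ?_
  exact ((Complex.measurable_ofReal.comp ((continuous_circleCos.measurable.comp
    (hg i hi)).const_mul δ)).mul_const _).const_add 1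

/-- If the Riesz products of two consecutive dyadic blocks are close to one, then so is the product
over the sibling. -/
lemma norm_rieszProd_sdiff_sub_one_sq_le {J : ℕ} (δ : ℝ) {s t : Finset (Fin J)} (hst : s ⊆ t)
    (θ : Fin J → UnitAddCircle) : ‖rieszProd δ (t \ s) θ - 1‖ ^ 2 ≤
      2 * (‖rieszProd δ s θ - 1‖ ^ 2 + ‖rieszProd δ t θ - 1‖ ^ 2) := by
  have h1 : rieszProd δ s θ * (rieszProd δ (t \ s) θ - 1) =
      (rieszProd δ t θ - 1) - (rieszProd δ s θ - 1) := by
    have : rieszProd δ t θ = rieszProd δ (t \ s) θ * rieszProd δ s θ :=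
      (Finset.prod_sdiff hst).symm
    rw [this]
    ring
  have h2 : ‖rieszProd δ (t \ s) θ - 1‖ ≤ ‖rieszProd δ s θ - 1‖ + ‖rieszProd δ t θ - 1‖ := by
    calc ‖rieszProd δ (t \ s) θ - 1‖ = 1 * ‖rieszProd δ (t \ s) θ - 1‖ := (one_mul _).symm
      _ ≤ ‖rieszProd δ s θ‖ * ‖rieszProd δ (t \ s) θ - 1‖ :=
        mul_le_mul_of_nonneg_right (one_le_norm_rieszProd s θ) (norm_nonneg _)
      _ = ‖(rieszProd δ t θ - 1) - (rieszProd δ s θ - 1)‖ := by rw [← h1, norm_mul]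
      _ ≤ _ := by
        rw [add_comm]
        exact norm_sub_le _ _
  calc _ ≤ (‖rieszProd δ s θ - 1‖ + ‖rieszProd δ t θ - 1‖) ^ 2 := by gcongr
    _ ≤ _ := add_sq_le

/-- For a suitable length `2 ^ m`, every point is contained in a dyadic block on which the Riesz
product is far from one, with high probability. -/
lemma exists_measureReal_forall_block_le (b : ℕ) :
    ∃ (m : ℕ) (δ : ℝ), 0 < δ ∧ δ ≤ 1 ∧ δ ^ 2 * 2 ^ m = 1 ∧ ∀ t < 2 ^ m,
      (torusMeasure (2 ^ m)).real {θ | ∀ k ≤ m,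
        192 * ‖rieszProd δ (dyadicBlock m k (t / 2 ^ k)) θ - 1‖ ^ 2 < 2 ^ b * δ ^ 2 * 2 ^ k} ≤
      1 / 4 := by
  set q : ℝ := (1 / 384 : ℝ) ^ 2 ^ b / 2 with hq
  have hq0 : 0 < q := by positivity
  have hq1 : q ≤ 1 := by
    have : (1 / 384 : ℝ) ^ 2 ^ b ≤ 1 := pow_le_one₀ (by norm_num) (by norm_num)
    rw [hq]
    linarith
  obtain ⟨M, hM⟩ := exists_pow_lt_of_lt_one (show (0 : ℝ) < 1 / 4 by norm_num)
    (show 1 - q < 1 by linarith)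
  obtain ⟨m₀, hm₀⟩ := exists_pow_lt_of_lt_one hq0 (show (1 / 2 : ℝ) < 1 by norm_num)
  -- The scales used are `b ≤ k < b + M`: `k ≥ b` lets a sibling split into `2 ^ b` equal pieces,
  -- `M` independent scales make `(1 - q) ^ M` small, and `m₀` ensures `2 ^ k δ² ≤ 2 ^ (-m₀) < q`.
  set m := b + M + m₀ with hm
  have hδ2 : Real.sqrt (1 / 2 ^ m) ^ 2 = 1 / 2 ^ m := Real.sq_sqrt (by positivity)
  refine ⟨m, Real.sqrt (1 / 2 ^ m), by positivity, ?_, ?_, ?_⟩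
  · refine Real.sqrt_le_one.2 ?_
    exact (div_le_one (by positivity)).2 (one_le_pow₀ (by norm_num))
  · rw [hδ2]
    field_simp
  intro t ht
  have hδ0 : 0 < Real.sqrt (1 / 2 ^ m) := by positivity
  have hδ1 : Real.sqrt (1 / 2 ^ m) ≤ 1 := by
    refine Real.sqrt_le_one.2 ?_
    exact (div_le_one (by positivity)).2 (one_le_pow₀ (by norm_num))
  set δ := Real.sqrt (1 / 2 ^ m)
  set E : ℕ → Set (Fin (2 ^ m) → UnitAddCircle) := fun k =>
    {θ | 32 * ‖rieszProd δ (dyadicSibling m k t) θ - 1‖ ^ 2 < 2 ^ b * δ ^ 2 * 2 ^ k} with hE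
  have hmeas : ∀ (m' : MeasurableSpace (Fin (2 ^ m) → UnitAddCircle)) (k : ℕ),
      (∀ i ∈ dyadicSibling m k t,
        @Measurable _ _ m' _ fun θ : Fin (2 ^ m) → UnitAddCircle => θ i) → MeasurableSet[m'] (E k) := by
    intro m' k h
    have := measurable_rieszProd δ (dyadicSibling m k t) (g := fun θ => θ) h
    exact measurableSet_lt (((this.sub_const 1).norm.pow_const 2).const_mul 32) measurable_const
  have hprod := measure_biInter_eq_prod_of_iIndep (μ := torusMeasure (2 ^ m))
    (m := fun i => MeasurableSpace.comap (fun θ : Fin (2 ^ m) → UnitAddCircle => θ i) inferInstance)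
    (fun i => (measurable_pi_apply i).comap_le)
    (ProbabilityTheory.iIndepFun_pi (X := fun _ t => t) fun _ => aemeasurable_id).iIndep
    (pairwise_disjoint_dyadicSibling m t) (E := E)
    (fun k => hmeas _ k fun i hi => (comap_measurable _).mono
      (le_iSup₂_of_le (f := fun i (_ : i ∈ (dyadicSibling m k t : Set (Fin (2 ^ m)))) =>
        MeasurableSpace.comap (fun θ : Fin (2 ^ m) → UnitAddCircle => θ i) inferInstance)
        i hi le_rfl) le_rfl)
    (Finset.Ico b (b + M))
  have hEk : ∀ k ∈ Finset.Ico b (b + M), (torusMeasure (2 ^ m)).real (E k) ≤ 1 - q := by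
    intro k hk
    obtain ⟨hk1, hk2⟩ := Finset.mem_Ico.1 hk
    have hcard : (dyadicSibling m k t).card = 2 ^ k := card_dyadicSibling (by omega) ht
    have h := measureReal_norm_rieszProd_sub_one_ge hδ0 hδ1 (n := 2 ^ (k - b)) (b := b)
      (by positivity) (dyadicSibling m k t)
      (by rw [hcard, ← pow_add]; congr 1; omega)
      (by
        rw [hcard, hδ2, ← hq]
        refine le_trans ?_ hm₀.le
        push_cast
        rw [mul_one_div, div_le_iff₀ (by positivity), one_div, inv_pow, ← div_eq_inv_mul,
          le_div_iff₀ (by positivity), ← pow_add]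
        exact pow_le_pow_right₀ (by norm_num) (by omega))
    have hEm : MeasurableSet (E k) := hmeas _ k fun i _ => measurable_pi_apply i
    have hc : (E k)ᶜ =
        {θ | 2 ^ b * δ ^ 2 * ((dyadicSibling m k t).card : ℝ) ≤
          32 * ‖rieszProd δ (dyadicSibling m k t) θ - 1‖ ^ 2} := by
      ext θ
      simp [hE, hcard]
    rw [← hc, measureReal_compl hEm, probReal_univ] at h
    linarith
  -- If the blocks at scales `k` and `k + 1` are both near one, so is the sibling; the constant is
  -- `192 = 32 · 2 · (1 + 2)`.
  have hsub : {θ | ∀ k ≤ m, 192 * ‖rieszProd δ (dyadicBlock m k (t / 2 ^ k)) θ - 1‖ ^ 2 <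
      2 ^ b * δ ^ 2 * 2 ^ k} ⊆ ⋂ k ∈ Finset.Ico b (b + M), E k := by
    intro θ hθ
    simp only [Set.mem_iInter]
    intro k hk
    obtain ⟨hk1, hk2⟩ := Finset.mem_Ico.1 hk
    have h1 := hθ k (by omega)
    have h2 := hθ (k + 1) (by omega)
    have h3 := norm_rieszProd_sdiff_sub_one_sq_le δ (dyadicBlock_subset_succ m k t) θ
    change 32 * ‖rieszProd δ (dyadicSibling m k t) θ - 1‖ ^ 2 < _
    rw [pow_succ (2 : ℝ) k] at h2
    unfold dyadicSibling
    linarith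
  calc _ ≤ (torusMeasure (2 ^ m)).real (⋂ k ∈ Finset.Ico b (b + M), E k) := measureReal_mono hsub
    _ = ∏ k ∈ Finset.Ico b (b + M), (torusMeasure (2 ^ m)).real (E k) := by
      rw [measureReal_def, hprod, ENNReal.toReal_prod]
      rfl
    _ ≤ ∏ k ∈ Finset.Ico b (b + M), (1 - q) :=
      Finset.prod_le_prod (fun _ _ => measureReal_nonneg) hEk
    _ = (1 - q) ^ M := by simp
    _ ≤ 1 / 4 := hM.le

open Classical in
/-- With probability at least one half, at least half of all points are covered by dyadic blocks on
which the Riesz product is far from one. -/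
lemma exists_measure_covered_ge (b : ℕ) :
    ∃ (m : ℕ) (δ : ℝ), 0 < δ ∧ δ ≤ 1 ∧ δ ^ 2 * 2 ^ m = 1 ∧
      ∃ S : Set (Fin (2 ^ m) → UnitAddCircle), MeasurableSet S ∧ 1 / 2 ≤ torusMeasure (2 ^ m) S ∧
      ∀ θ ∈ S, (2 : ℝ) ^ m / 2 ≤ ((Finset.range (2 ^ m)).filter fun t => ∃ k ≤ m,
        2 ^ b * δ ^ 2 * 2 ^ k ≤
          192 * ‖rieszProd δ (dyadicBlock m k (t / 2 ^ k)) θ - 1‖ ^ 2).card := by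
  obtain ⟨m, δ, h0, h1, h2, h⟩ := exists_measureReal_forall_block_le b
  refine ⟨m, δ, h0, h1, h2, ?_⟩
  set U : ℕ → Set (Fin (2 ^ m) → UnitAddCircle) := fun t => {θ | ∀ k ≤ m,
    192 * ‖rieszProd δ (dyadicBlock m k (t / 2 ^ k)) θ - 1‖ ^ 2 < 2 ^ b * δ ^ 2 * 2 ^ k} with hU
  have hUm : ∀ t, MeasurableSet (U t) := by
    intro t
    simp only [hU, Set.ofPred_forall]
    refine MeasurableSet.iInter fun k => MeasurableSet.iInter fun _ => ?_
    have := measurable_rieszProd δ (dyadicBlock m k (t / 2 ^ k)) (g := fun θ => θ)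
      fun i _ => measurable_pi_apply i
    exact measurableSet_lt (((this.sub_const 1).norm.pow_const 2).const_mul 192) measurable_const
  set Y : (Fin (2 ^ m) → UnitAddCircle) → ℝ := fun θ =>
    ∑ t ∈ Finset.range (2 ^ m), (U t).indicator (fun _ => 1) θ with hY
  have hYm : Measurable Y := Finset.measurable_sum _ fun t _ => measurable_const.indicator (hUm t)
  have hYi : ∀ t, Integrable ((U t).indicator fun _ => (1 : ℝ)) (torusMeasure (2 ^ m)) :=
    fun t => (integrable_const _).indicator (hUm t)
  have hYint : ∫ θ, Y θ ∂torusMeasure (2 ^ m) ≤ 2 ^ m * (1 / 4) := by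
    rw [hY, integral_finsetSum _ fun t _ => hYi t]
    calc _ ≤ ∑ t ∈ Finset.range (2 ^ m), (1 / 4 : ℝ) := by
          refine Finset.sum_le_sum fun t ht => ?_
          rw [integral_indicator_const _ (hUm t), smul_eq_mul, mul_one]
          exact h t (Finset.mem_range.1 ht)
      _ = _ := by simp
  -- Markov's inequality: on average at most a quarter of the points are uncovered, so at least half
  -- are uncovered with probability at most one half.
  have hch := mul_meas_ge_le_integral_of_nonneg (μ := torusMeasure (2 ^ m)) (f := Y)
    (Filter.Eventually.of_forall fun θ => Finset.sum_nonneg fun t _ =>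
      Set.indicator_nonneg (fun _ _ => zero_le_one) θ)
    (integrable_finsetSum _ fun t _ => hYi t) (2 ^ m / 2)
  set B := {θ | (2 : ℝ) ^ m / 2 ≤ Y θ}
  have hB : MeasurableSet B := measurableSet_le measurable_const hYm
  have hBr : (torusMeasure (2 ^ m)).real B ≤ 1 / 2 := by
    have h3 : (0 : ℝ) < 2 ^ m / 2 := by positivity
    refine le_of_mul_le_mul_left ?_ h3
    linarith
  refine ⟨Bᶜ, hB.compl, ?_, ?_⟩
  · have h4 : 1 / 2 ≤ (torusMeasure (2 ^ m)).real Bᶜ := by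
      rw [measureReal_compl hB, probReal_univ]
      linarith
    rw [← ENNReal.ofReal_le_ofReal_iff measureReal_nonneg, ofReal_measureReal] at h4
    refine le_trans (le_of_eq ?_) h4
    rw [ENNReal.ofReal_div_of_pos two_pos]
    simp
  · intro θ hθ
    have h5 : Y θ < 2 ^ m / 2 := not_le.1 hθ
    have h6 : Y θ = ((Finset.range (2 ^ m)).filter fun t => θ ∈ U t).card := by
      simp only [hY, Set.indicator_apply]
      rw [Finset.sum_boole]
    have h7 := Finset.card_filter_add_card_filter_not (s := Finset.range (2 ^ m))
      (fun t => θ ∈ U t)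
    have h8 : ((Finset.range (2 ^ m)).filter fun t => ¬ θ ∈ U t) =
        (Finset.range (2 ^ m)).filter fun t => ∃ k ≤ m, 2 ^ b * δ ^ 2 * 2 ^ k ≤
          192 * ‖rieszProd δ (dyadicBlock m k (t / 2 ^ k)) θ - 1‖ ^ 2 := by
      refine Finset.filter_congr fun t _ => ?_
      simp only [hU]
      change (¬ ∀ k ≤ m, _ < _) ↔ _
      push Not
      rfl
    rw [← h8]
    rw [Finset.card_range] at h7
    have h9 := congrArg (Nat.cast (R := ℝ)) h7
    push_cast at h9
    rw [h6] at h5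
    linarith

/-! ### Rotations of tori with large quadratic variation -/

lemma addLeft_zpow_apply {G : Type*} [AddCommGroup G] (α x : G) (z : ℤ) :
    ((Equiv.addLeft α : Equiv.Perm G) ^ z) x = z • α + x := by
  have h : ∀ y : G, ((Equiv.addLeft α : Equiv.Perm G)⁻¹) y = -α + y := fun y => rfl
  induction z using Int.induction_on generalizing x with
  | zero => simp
  | succ n ih => rw [zpow_add_one, Equiv.Perm.mul_apply, ih, Equiv.coe_addLeft, add_smul, one_smul,
      add_assoc]
  | pred n ih => rw [zpow_sub_one, Equiv.Perm.mul_apply, ih, h, sub_smul, one_smul, sub_eq_add_neg,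
      add_assoc]

/-- The bounded test function on the torus: one half of the full Riesz product. -/
noncomputable def rieszTest (J : ℕ) (δ : ℝ) (θ : Fin J → UnitAddCircle) : ℂ :=
  1 / 2 * rieszProd δ Finset.univ θ

/-- Each factor has squared modulus at most `1 + δ² ≤ exp (δ²)`, so the product has squared modulus
at most `e < 4`. -/
lemma norm_rieszTest_le_one {J : ℕ} {δ : ℝ} (h : δ ^ 2 * J = 1) (θ : Fin J → UnitAddCircle) :
    ‖rieszTest J δ θ‖ ≤ 1 := by
  have h1 : ∀ i : Fin J, ‖1 + ((δ * circleCos (θ i) : ℝ) : ℂ) * Complex.I‖ ^ 2 ≤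
      Real.exp (δ ^ 2) := by
    intro i
    have : circleCos (θ i) ^ 2 ≤ 1 := (sq_le_one_iff_abs_le_one _).2 (abs_circleCos_le _)
    have e : ‖1 + ((δ * circleCos (θ i) : ℝ) : ℂ) * Complex.I‖ ^ 2 =
        1 + δ ^ 2 * circleCos (θ i) ^ 2 := by
      rw [← Complex.normSq_eq_norm_sq, Complex.normSq_apply]
      simp
      ring
    rw [e]
    calc _ ≤ δ ^ 2 + 1 := by nlinarith [sq_nonneg δ]
      _ ≤ _ := Real.add_one_le_exp _
  have h2 : ‖rieszProd δ Finset.univ θ‖ ^ 2 ≤ 2 ^ 2 := by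
    rw [rieszProd, norm_prod, ← Finset.prod_pow]
    calc _ ≤ ∏ _i : Fin J, Real.exp (δ ^ 2) :=
          Finset.prod_le_prod (fun _ _ => by positivity) fun i _ => h1 i
      _ = Real.exp 1 := by
        rw [Finset.prod_const, Finset.card_univ, Fintype.card_fin, ← Real.exp_nat_mul, mul_comm, h]
      _ ≤ _ := by linarith [Real.exp_one_lt_d9]
  have h3 := le_of_sq_le_sq h2 zero_le_two
  rw [rieszTest, norm_mul]
  norm_num
  linarith

lemma measurable_rieszTest (J : ℕ) (δ : ℝ) : Measurable (rieszTest J δ) :=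
  (measurable_rieszProd δ Finset.univ (g := fun θ => θ) fun i _ =>
    measurable_pi_apply i).const_mul _

/-- The two partial products differ by the factor over the block. The remaining common product has
modulus at least `1` and can be dropped. -/
lemma half_norm_sub_one_le_of_approx {m k a : ℕ} {δ η : ℝ} {A : ℕ → ℂ}
    {θ : Fin (2 ^ m) → UnitAddCircle}
    (hA : ∀ j ≤ 2 ^ m,
      ‖A j - 1 / 2 * rieszProd δ (Finset.univ.filter fun i : Fin (2 ^ m) => j ≤ i.val) θ‖ ≤ η)
    (ha : (a + 1) * 2 ^ k ≤ 2 ^ m) :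
    ‖rieszProd δ (dyadicBlock m k a) θ - 1‖ / 2 ≤
      ‖A ((a + 1) * 2 ^ k) - A (a * 2 ^ k)‖ + 2 * η := by
  set s := Finset.univ.filter fun i : Fin (2 ^ m) => (a + 1) * 2 ^ k ≤ i.val with hs
  set t := Finset.univ.filter fun i : Fin (2 ^ m) => a * 2 ^ k ≤ i.val with ht
  have hle : a * 2 ^ k ≤ (a + 1) * 2 ^ k := Nat.mul_le_mul_right _ (by omega)
  have hst : s ⊆ t := by
    intro i hi
    simp only [hs, ht, Finset.mem_filter, Finset.mem_univ, true_and] at hi ⊢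
    omega
  have hb : t \ s = dyadicBlock m k a := by
    ext i
    simp only [hs, ht, dyadicBlock, Finset.mem_filter, Finset.mem_univ, true_and, Finset.mem_sdiff]
    rw [Nat.div_eq_iff (by positivity), add_mul]
    have : 0 < 2 ^ k := by positivity
    omega
  have hprod : rieszProd δ t θ = rieszProd δ (dyadicBlock m k a) θ * rieszProd δ s θ := by
    rw [← hb]
    exact (Finset.prod_sdiff hst).symm
  have h1 := hA _ ha
  have h2 := hA _ (hle.trans ha)
  have h3 : ‖rieszProd δ (dyadicBlock m k a) θ - 1‖ / 2 ≤
      ‖1 / 2 * rieszProd δ s θ - 1 / 2 * rieszProd δ t θ‖ := by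
    have e : 1 / 2 * rieszProd δ s θ - 1 / 2 * rieszProd δ t θ =
        -(1 / 2 * (rieszProd δ s θ * (rieszProd δ (dyadicBlock m k a) θ - 1))) := by
      rw [hprod]
      ring
    rw [e, norm_neg, norm_mul, norm_mul]
    have := mul_le_mul_of_nonneg_right (one_le_norm_rieszProd (δ := δ) s θ)
      (norm_nonneg (rieszProd δ (dyadicBlock m k a) θ - 1))
    norm_num at this ⊢
    linarith
  refine h3.trans ?_
  have e : 1 / 2 * rieszProd δ s θ - 1 / 2 * rieszProd δ t θ =
      (A ((a + 1) * 2 ^ k) - A (a * 2 ^ k)) - (A ((a + 1) * 2 ^ k) - 1 / 2 * rieszProd δ s θ) +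
        (A (a * 2 ^ k) - 1 / 2 * rieszProd δ t θ) := by ring
  rw [e]
  refine (norm_add_le _ _).trans ?_
  have := norm_sub_le (A ((a + 1) * 2 ^ k) - A (a * 2 ^ k))
    (A ((a + 1) * 2 ^ k) - 1 / 2 * rieszProd δ s θ)
  linarith

/-- There are rotations of tori for which the averages of the test function along a subsequence of a
given infinite set have large quadratic variation with probability at least one half. -/
lemma exists_rotation_sum_sq_ge (P : Polynomial ℤ) (hP : P.natDegree ≠ 0) (I : Set ℕ)
    (hI : I.Infinite) (hI1 : ∀ N ∈ I, 1 ≤ N) (b : ℕ) :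
    ∃ (J : ℕ) (δ : ℝ) (α : Fin J → UnitAddCircle) (S : Set (Fin J → UnitAddCircle)),
      δ ^ 2 * J = 1 ∧ MeasurableSet S ∧ 1 / 2 ≤ torusMeasure J S ∧
      ∀ θ ∈ S, ∃ (L : ℕ) (t : Fin (L + 1) → ℕ), 1 ≤ L ∧ Monotone t ∧ (∀ j, t j ∈ I) ∧
        (2 : ℝ) ^ b / 6144 ≤ ∑ j : Fin L,
          ‖((t j.succ : ℂ)⁻¹ * ∑ n ∈ Finset.Icc 1 (t j.succ),
              rieszTest J δ (P.eval (n : ℤ) • α + θ)) -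
            ((t j.castSucc : ℂ)⁻¹ * ∑ n ∈ Finset.Icc 1 (t j.castSucc),
              rieszTest J δ (P.eval (n : ℤ) • α + θ))‖ ^ 2 := by
  classical
  obtain ⟨m, δ, hδ0, hδ1, hδm, S, hSm, hS, hcov⟩ := exists_measure_covered_ge b
  set τ : ℝ := 2 ^ b * δ ^ 2 / 192 with hτ
  have hτ0 : 0 < τ := by positivity
  -- The approximation error `2η = √τ / 4` is at most half of `z / 2` below, since a good block has
  -- `z ≥ √τ` even at the smallest scale.
  set η : ℝ := Real.sqrt τ / 8 with hη
  have hη0 : 0 < η := by positivity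
  obtain ⟨N, α, hN1, hN2, hN3⟩ := exists_frequencies P hP I hI hI1
    (ε := η / ((signBox (2 ^ m)).card + 1)) (by positivity) (2 ^ m)
  refine ⟨2 ^ m, δ, α, S, by exact_mod_cast hδm, hSm, hS, fun θ hθ => ?_⟩
  set avg : ℕ → ℂ := fun M => (M : ℂ)⁻¹ * ∑ n ∈ Finset.Icc 1 M,
    rieszTest (2 ^ m) δ (P.eval (n : ℤ) • α + θ) with havg
  have hA : ∀ j ≤ 2 ^ m, ‖avg (N j) -
      1 / 2 * rieszProd δ (Finset.univ.filter fun i : Fin (2 ^ m) => j ≤ i.val) θ‖ ≤ η := by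
    intro j hj
    have h := norm_average_sub_rieszProd_le P (N j) (δ := δ)
      (by rw [abs_of_pos hδ0]; linarith) α (hN3 j hj) θ
    have e : avg (N j) = 1 / 2 * ((N j : ℂ)⁻¹ * ∑ n ∈ Finset.Icc 1 (N j),
        rieszProd δ Finset.univ (P.eval (n : ℤ) • α + θ)) := by
      simp only [havg, rieszTest, ← Finset.mul_sum]
      ring
    rw [e, ← mul_sub, norm_mul]
    have h' : (signBox (2 ^ m)).card * (η / ((signBox (2 ^ m)).card + 1)) ≤ η := by
      rw [mul_div_assoc', div_le_iff₀ (by positivity)]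
      nlinarith
    have h'' := h.trans h'
    calc _ ≤ ‖(1 / 2 : ℂ)‖ * η := by gcongr
      _ ≤ η := by
        norm_num
        linarith
  obtain ⟨L, t, htm, ht0, htL, hsum⟩ := exists_partition_sum_sq_ge (fun j => avg (N j))
    (κ := τ / 16) (by positivity) m 0
  simp only [zero_mul, zero_add, one_mul] at ht0 htL
  have hgood : ∀ x < 2 ^ m, ∀ l ≤ m,
      2 ^ b * δ ^ 2 * 2 ^ l ≤ 192 * ‖rieszProd δ (dyadicBlock m l (x / 2 ^ l)) θ - 1‖ ^ 2 →
      τ / 16 * 2 ^ l ≤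
        ‖avg (N ((x / 2 ^ l + 1) * 2 ^ l)) - avg (N (x / 2 ^ l * 2 ^ l))‖ ^ 2 := by
    intro x hx l hl h
    have h1 := half_norm_sub_one_le_of_approx (A := fun j => avg (N j)) hA
      (div_two_pow_add_one_mul_le hl hx)
    set z := ‖rieszProd δ (dyadicBlock m l (x / 2 ^ l)) θ - 1‖
    have hz : τ * 2 ^ l ≤ z ^ 2 := by
      rw [hτ, div_mul_eq_mul_div, div_le_iff₀ (by norm_num)]
      linarith
    have hz' : Real.sqrt τ ≤ z := by
      refine Real.sqrt_le_iff.2 ⟨norm_nonneg _, le_trans ?_ hz⟩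
      exact le_mul_of_one_le_right hτ0.le (one_le_pow₀ (by norm_num))
    have h2 : z / 4 ≤ ‖avg (N ((x / 2 ^ l + 1) * 2 ^ l)) - avg (N (x / 2 ^ l * 2 ^ l))‖ := by
      simp only [hη] at h1
      linarith
    calc τ / 16 * 2 ^ l ≤ (z / 4) ^ 2 := by
          rw [div_pow]
          linarith
      _ ≤ _ := pow_le_pow_left₀ (by positivity) h2 2
  have hcard : (2 : ℝ) ^ b / 6144 ≤
      ∑ j ∈ Finset.range L, ‖avg (N (t (j + 1))) - avg (N (t j))‖ ^ 2 := by
    refine le_trans ?_ hsum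
    have h1 := hcov θ hθ
    have h2 : ((Finset.range (2 ^ m)).filter fun t => ∃ k ≤ m, 2 ^ b * δ ^ 2 * 2 ^ k ≤
        192 * ‖rieszProd δ (dyadicBlock m k (t / 2 ^ k)) θ - 1‖ ^ 2).card ≤
        ((Finset.Ico (0 * 2 ^ m) ((0 + 1) * 2 ^ m)).filter fun x => ∃ l ≤ m, τ / 16 * 2 ^ l ≤
          ‖avg (N ((x / 2 ^ l + 1) * 2 ^ l)) - avg (N (x / 2 ^ l * 2 ^ l))‖ ^ 2).card := by
      refine Finset.card_le_card fun x hx => ?_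
      obtain ⟨hx1, l, hl, hx2⟩ := Finset.mem_filter.1 hx
      have hx3 := Finset.mem_range.1 hx1
      exact Finset.mem_filter.2 ⟨by simpa using hx3, l, hl, hgood x hx3 l hl hx2⟩
    have h3 := h1.trans (Nat.cast_le.2 h2)
    -- Here `6144 = 192 · 16 · 2`: the constant in `τ`, the loss from `(z / 4)²`, and the half of
    -- the points that is covered.
    calc (2 : ℝ) ^ b / 6144 = τ / 16 * (2 ^ m / 2) := by
          rw [hτ]
          calc (2 : ℝ) ^ b / 6144 = 2 ^ b / 6144 * (δ ^ 2 * 2 ^ m) := by rw [hδm, mul_one]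
            _ = _ := by ring
      _ ≤ _ := mul_le_mul_of_nonneg_left h3 (by positivity)
  have hNmono : ∀ i j, i ≤ j → j ≤ 2 ^ m → N i ≤ N j := by
    intro i j hij
    induction j, hij using Nat.le_induction with
    | base => exact fun _ => le_rfl
    | succ j _ ih => exact fun hj => (ih (by omega)).trans (hN2 j (by omega)).le
  have htle : ∀ j : Fin (L + 1), t j.val ≤ 2 ^ m := fun j => by
    rw [← htL]
    exact htm (by omega)
  refine ⟨L, fun j => N (t j.val), ?_, ?_, fun j => hN1 _ (htle j), ?_⟩
  · by_contra h
    obtain rfl : L = 0 := by omega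
    have : 0 < 2 ^ m := by positivity
    omega
  · intro i j hij
    exact hNmono _ _ (htm hij) (htle j)
  · rw [Finset.sum_range] at hcard
    exact hcard

/-! ### From quadratic variation to the failure of the estimate -/

/-- Lower bound for the `r`-variation, `r ≤ 2`, by the sum of squares of bounded increments. -/
lemma ofReal_rpow_le_rVariation {r : ℝ} (hr : 0 < r) (hr2 : r ≤ 2) {I : Set ℕ} {a : ℕ → ℂ}
    (ha : ∀ N, ‖a N‖ ≤ 1) {D : ℝ} {L : ℕ} (hL : 1 ≤ L) {t : Fin (L + 1) → ℕ} (ht : Monotone t)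
    (htI : ∀ j, t j ∈ I) (hD : D ≤ ∑ j : Fin L, ‖a (t j.succ) - a (t j.castSucc)‖ ^ 2) :
    ENNReal.ofReal (D / 4) ^ (1 / r) ≤ rVariation r I a := by
  unfold rVariation
  refine le_iSup_of_le L (le_iSup_of_le hL (le_iSup_of_le t (le_iSup_of_le ht
    (le_iSup_of_le htI ?_))))
  refine ENNReal.rpow_le_rpow ?_ (by positivity)
  have h1 : ∀ j : Fin L, ENNReal.ofReal (‖a (t j.succ) - a (t j.castSucc)‖ ^ 2 / 4) ≤
      ‖a (t j.succ) - a (t j.castSucc)‖ₑ ^ r := by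
    intro j
    rw [← ofReal_norm, ENNReal.ofReal_rpow_of_nonneg (norm_nonneg _) hr.le]
    refine ENNReal.ofReal_le_ofReal ?_
    set x := ‖a (t j.succ) - a (t j.castSucc)‖
    -- Increments are at most `2`, so `x / 2 ≤ 1` and lowering the exponent from `2` to `r` only
    -- increases the power.
    have hx2 : x ≤ 2 := (norm_sub_le _ _).trans (by linarith [ha (t j.succ), ha (t j.castSucc)])
    rcases (norm_nonneg _ : 0 ≤ x).eq_or_lt with h0 | h0
    · have hx0 : x = 0 := h0.symm
      rw [hx0]
      simp [Real.zero_rpow hr.ne']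
    · calc x ^ 2 / 4 = (x / 2) ^ (2 : ℝ) := by
            rw [Real.rpow_two]
            ring
        _ ≤ (x / 2) ^ r := Real.rpow_le_rpow_of_exponent_ge (by positivity) (by linarith) hr2
        _ ≤ x ^ r := Real.rpow_le_rpow (by positivity) (by linarith) hr.le
  calc ENNReal.ofReal (D / 4)
      ≤ ENNReal.ofReal (∑ j : Fin L, ‖a (t j.succ) - a (t j.castSucc)‖ ^ 2 / 4) := by
        refine ENNReal.ofReal_le_ofReal ?_
        rw [← Finset.sum_div]
        linarith
    _ = ∑ j : Fin L, ENNReal.ofReal (‖a (t j.succ) - a (t j.castSucc)‖ ^ 2 / 4) :=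
      ENNReal.ofReal_sum_of_nonneg fun _ _ => by positivity
    _ ≤ _ := Finset.sum_le_sum fun j _ => h1 j

/-- The right side stays at most `C`, as all functions are bounded by `1` on a probability space,
while the variation exceeds any bound on a set of measure at least `1/2`. -/
theorem not_exists_variational_estimate {k : ℕ} (P : Fin k → Polynomial ℤ)
    (hP : ¬ ∀ i, ∃ c : ℤ, P i = Polynomial.C c) (q : Fin k → ℝ≥0∞) {p : ℝ≥0∞} {r : ℝ}
    (hp : 0 < p) (hr : 0 < r) (hr2 : r ≤ 2) (I : Set ℕ) (hI1 : ∀ N ∈ I, 1 ≤ N) (hI : I.Infinite) :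
    ¬ ∃ C : ℝ, 0 < C ∧
      ∀ (X : Type) [MeasurableSpace X] (μ : Measure X) [IsProbabilityMeasure μ]
        (T : X ≃ᵐ X), MeasurePreserving T μ μ →
      ∀ f : Fin k → X → ℂ, (∀ i, MemLp (f i) (q i) μ) →
        eLpNorm (fun x => rVariation r I fun N : ℕ => polyErgodicAverage T P f N x) p μ ≤
          ENNReal.ofReal C * ∏ i, eLpNorm (f i) (q i) μ := by
  rintro ⟨C, hC0, hC⟩
  obtain ⟨i₀, hi₀⟩ := not_forall.1 hP
  have hdeg : (P i₀).natDegree ≠ 0 := fun h =>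
    hi₀ ⟨_, Polynomial.eq_C_of_natDegree_eq_zero h⟩
  -- Lower bound for the L^p norm of the indicator of `S`. For `p = ∞` the exponent is `1 / 0 = 0`,
  -- so `w = 1`, as it should be.
  set w : ℝ := (1 / 2 : ℝ) ^ (1 / p.toReal) with hw
  have hw0 : 0 < w := by positivity
  -- Here `24576 = 6144 · 4`, the `4` coming from the passage from squares to `r`-th powers.
  obtain ⟨b, hb⟩ := pow_unbounded_of_one_lt ((C / w) ^ r * 24576) (one_lt_two (α := ℝ))
  obtain ⟨J, δ, α, S, hδ, hSm, hS, hvar⟩ := exists_rotation_sum_sq_ge (P i₀) hdeg I hI hI1 b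
  set f : Fin k → (Fin J → UnitAddCircle) → ℂ := fun i => if i = i₀ then rieszTest J δ else 1 with hf
  have hfm : ∀ i, AEStronglyMeasurable (f i) (torusMeasure J) := by
    intro i
    simp only [hf]
    split_ifs
    exacts [(measurable_rieszTest J δ).aestronglyMeasurable, aestronglyMeasurable_const]
  have hf1 : ∀ i θ, ‖f i θ‖ ≤ 1 := by
    intro i θ
    simp only [hf]
    split_ifs
    exacts [norm_rieszTest_le_one hδ θ, by simp]
  have h := hC (Fin J → UnitAddCircle) (torusMeasure J) (MeasurableEquiv.addLeft α)
    (measurePreserving_add_left _ α) f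
    fun i => MemLp.of_bound (hfm i) 1 (Filter.Eventually.of_forall (hf1 i))
  have hnorm : ∏ i, eLpNorm (f i) (q i) (torusMeasure J) ≤ 1 := by
    refine Finset.prod_le_one' fun i _ => ?_
    refine (eLpNorm_le_of_ae_bound (Filter.Eventually.of_forall (hf1 i))).trans ?_
    simp
  have h' : _ ≤ ENNReal.ofReal C * 1 := h.trans (mul_le_mul_right hnorm _)
  rw [mul_one] at h'
  have havg : ∀ (N : ℕ) (θ : Fin J → UnitAddCircle),
      polyErgodicAverage (MeasurableEquiv.addLeft α) P f N θ =
        (N : ℂ)⁻¹ * ∑ n ∈ Finset.Icc 1 N, rieszTest J δ ((P i₀).eval (n : ℤ) • α + θ) := by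
    intro N θ
    rw [polyErgodicAverage, Nat.floor_natCast]
    congr 1
    refine Finset.sum_congr rfl fun n _ => ?_
    rw [Finset.prod_eq_single i₀]
    · simp only [hf, if_true]
      exact congrArg _ (addLeft_zpow_apply α θ _)
    · intro i _ hi
      simp [hf, hi]
    · exact fun hi => absurd (Finset.mem_univ _) hi
  have havg1 : ∀ (N : ℕ) (θ : Fin J → UnitAddCircle),
      ‖polyErgodicAverage (MeasurableEquiv.addLeft α) P f N θ‖ ≤ 1 := by
    intro N θ
    rw [havg, norm_mul, norm_inv, Complex.norm_natCast]
    have : ‖∑ n ∈ Finset.Icc 1 N, rieszTest J δ ((P i₀).eval (n : ℤ) • α + θ)‖ ≤ N := by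
      refine (norm_sum_le_of_le _ fun n _ => norm_rieszTest_le_one hδ _).trans ?_
      simp
    calc _ ≤ (N : ℝ)⁻¹ * N := by gcongr
      _ ≤ 1 := inv_mul_le_one
  set c : ℝ := ((2 : ℝ) ^ b / 6144 / 4) ^ (1 / r) with hc
  have hc0 : 0 < c := by positivity
  have hlow : ∀ θ ∈ S, ENNReal.ofReal c ≤ rVariation r I fun N : ℕ =>
      polyErgodicAverage (MeasurableEquiv.addLeft α) P f N θ := by
    intro θ hθ
    obtain ⟨L, t, hL, ht, htI, hsum⟩ := hvar θ hθ
    rw [hc, ← ENNReal.ofReal_rpow_of_nonneg (by positivity) (by positivity)]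
    refine ofReal_rpow_le_rVariation hr hr2 (fun N => havg1 N θ) hL ht htI ?_
    simp only [havg]
    exact hsum
  have hS0 : torusMeasure J S ≠ 0 := by
    intro h0
    rw [h0] at hS
    simp at hS
  have hchain : ENNReal.ofReal (c * w) ≤ ENNReal.ofReal C := by
    refine le_trans ?_ h'
    calc ENNReal.ofReal (c * w) = ENNReal.ofReal c * (1 / 2) ^ (1 / p.toReal) := by
          have hwe : ENNReal.ofReal w = (1 / 2) ^ (1 / p.toReal) := by
            rw [hw, ← ENNReal.ofReal_rpow_of_nonneg (by norm_num) (by positivity),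
              ENNReal.ofReal_div_of_pos two_pos]
            simp
          rw [ENNReal.ofReal_mul hc0.le, hwe]
      _ ≤ ENNReal.ofReal c * torusMeasure J S ^ (1 / p.toReal) := by gcongr
      _ = eLpNorm (S.indicator fun _ => ENNReal.ofReal c) p (torusMeasure J) := by
        rw [eLpNorm_indicator_const' hSm hS0 hp.ne', enorm_eq_self]
      _ ≤ _ := by
        refine eLpNorm_mono_enorm fun θ => ?_
        by_cases hθ : θ ∈ S
        · rw [Set.indicator_of_mem hθ]
          exact hlow θ hθ
        · rw [Set.indicator_of_notMem hθ]
          simp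
  rw [ENNReal.ofReal_le_ofReal_iff hC0.le, ← le_div_iff₀ hw0, hc,
    one_div, Real.rpow_inv_le_iff_of_pos (by positivity) (by positivity) hr] at hchain
  linarith

/-! ### Lacunary real times and the bilinear case -/

/-- Choosing one real time above each integer part turns an integer chain into a real chain with the
same values; it stays monotone because the floor is monotone. -/
lemma rVariation_natFloor_le (r : ℝ) {D : ℕ → ℝ} (F : ℝ → ℂ)
    (hF : ∀ N, F (⌊N⌋₊ : ℝ) = F N) :
    rVariation r (Set.range fun j => ⌊D j⌋₊) (fun N : ℕ => F N) ≤ rVariation r (Set.range D) F := by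
  classical
  have hex : ∀ N : ℕ, ∃ y : ℝ, N ∈ (Set.range fun j => ⌊D j⌋₊) → y ∈ Set.range D ∧ ⌊y⌋₊ = N := by
    intro N
    by_cases h : N ∈ Set.range fun j => ⌊D j⌋₊
    · obtain ⟨j, hj⟩ := h
      exact ⟨D j, fun _ => ⟨⟨j, rfl⟩, hj⟩⟩
    · exact ⟨0, fun h' => absurd h' h⟩
  choose y hy using hex
  unfold rVariation
  refine iSup_le fun J => iSup_le fun hJ => iSup_le fun t => iSup_le fun ht => iSup_le fun htI => ?_
  refine le_iSup_of_le J (le_iSup_of_le hJ (le_iSup_of_le (fun j => y (t j)) (le_iSup_of_le ?_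
    (le_iSup_of_le (fun j => (hy _ (htI j)).1) (le_of_eq ?_)))))
  · intro i j hij
    rcases (ht hij).eq_or_lt with h | h
    · simp only [h, le_refl]
    · by_contra hlt
      have := Nat.floor_le_floor (not_le.1 hlt).le
      dsimp only at this
      rw [(hy _ (htI i)).2, (hy _ (htI j)).2] at this
      omega
  · have e : ∀ j, F (y (t j)) = F (t j) := fun j => by rw [← hF, (hy _ (htI j)).2]
    simp only [e]

lemma infinite_range_natFloor_of_lacunary {l : ℝ} {D : ℕ → ℝ} (hl : 1 < l) (hD0 : 1 ≤ D 0)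
    (hD : ∀ j, l < D (j + 1) / D j) :
    (∀ j, 1 ≤ D j) ∧ (Set.range fun j => ⌊D j⌋₊).Infinite := by
  have hpow : ∀ j, l ^ j ≤ D j := by
    intro j
    induction j with
    | zero => simpa using hD0
    | succ j ih =>
      have hpos : 0 < D j := lt_of_lt_of_le (by positivity) ih
      have := (lt_div_iff₀ hpos).1 (hD j)
      calc l ^ (j + 1) = l * l ^ j := pow_succ' _ _
        _ ≤ l * D j := by gcongr
        _ ≤ _ := this.le
  refine ⟨fun j => (one_le_pow₀ hl.le).trans (hpow j), ?_⟩
  refine Set.infinite_of_not_bddAbove ?_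
  rintro ⟨B, hB⟩
  obtain ⟨j, hj⟩ := pow_unbounded_of_one_lt ((B : ℝ) + 1) hl
  have h1 : ⌊D j⌋₊ ≤ B := hB ⟨j, rfl⟩
  have h2 := Nat.lt_floor_add_one (D j)
  have h3 : ((⌊D j⌋₊ : ℕ) : ℝ) ≤ B := Nat.cast_le.2 h1
  have h4 := hpow j
  linarith

theorem mainTheorem8 :
    -- no variational estimate for `0 < r ≤ 2`, uniformly over probability systems
    (∀ (k : ℕ) (P : Fin k → Polynomial ℤ), (¬ ∀ i, ∃ c : ℤ, P i = Polynomial.C c) →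
      ∀ (q : Fin k → ℝ≥0∞) (p : ℝ≥0∞) (r : ℝ), (∀ i, 0 < q i) → 0 < p → 0 < r → r ≤ 2 →
      ∀ I : Set ℕ, (∀ N ∈ I, 1 ≤ N) → I.Infinite →
        ¬ ∃ C : ℝ, 0 < C ∧
          ∀ (X : Type) [MeasurableSpace X] (μ : Measure X) [IsProbabilityMeasure μ]
            (T : X ≃ᵐ X), MeasurePreserving T μ μ →
          ∀ f : Fin k → X → ℂ, (∀ i, MemLp (f i) (q i) μ) →
            eLpNorm (fun x => rVariation r I fun N : ℕ => polyErgodicAverage T P f N x) p μ ≤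
              ENNReal.ofReal C * ∏ i, eLpNorm (f i) (q i) μ) ∧
    -- sharpness of `r > 2` in the bilinear long variational ergodic theorem
    (∀ P : Polynomial ℤ, 2 ≤ P.natDegree →
      ∀ p₁ p₂ p : ℝ≥0∞, 1 < p₁ → p₁ < ∞ → 1 < p₂ → p₂ < ∞ → p₁⁻¹ + p₂⁻¹ = p⁻¹ → p⁻¹ ≤ 1 →
      ∀ r : ℝ, 0 < r → r ≤ 2 →
      ∀ (l : ℝ) (D : ℕ → ℝ), 1 < l → 1 ≤ D 0 → (∀ j, l < D (j + 1) / D j) →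
        ¬ ∃ C : ℝ, 0 < C ∧
          ∀ (X : Type) [MeasurableSpace X] (μ : Measure X) [IsProbabilityMeasure μ]
            (T : X ≃ᵐ X), MeasurePreserving T μ μ →
          ∀ f g : X → ℂ, MemLp f p₁ μ → MemLp g p₂ μ →
            eLpNorm (fun x => rVariationNorm r (Set.range D) fun N : ℝ =>
                polyErgodicAverage T ![Polynomial.X, P] ![f, g] N x) p μ ≤
              ENNReal.ofReal C * (eLpNorm f p₁ μ * eLpNorm g p₂ μ)) := by

  refine ⟨fun k P hP q p r _ hp hr hr2 I hI1 hI =>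
    not_exists_variational_estimate P hP q hp hr hr2 I hI1 hI, ?_⟩
  rintro P - p₁ p₂ p - - - - - hp r hr hr2 l D hl hD0 hD ⟨C, hC0, hC⟩
  obtain ⟨hD1, hinf⟩ := infinite_range_natFloor_of_lacunary hl hD0 hD
  -- The value `p = 0` would give `p⁻¹ = ∞`, against `p⁻¹ ≤ 1`.
  have hp0 : 0 < p := by
    rw [pos_iff_ne_zero]
    rintro rfl
    simp at hp
  refine not_exists_variational_estimate ![Polynomial.X, P] ?_ ![p₁, p₂] hp0 hr hr2
    (Set.range fun j => ⌊D j⌋₊) ?_ hinf ⟨C, hC0, ?_⟩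
  · intro h
    obtain ⟨c, hc⟩ := h 0
    have := congrArg Polynomial.natDegree hc
    simp at this
  · rintro _ ⟨j, rfl⟩
    exact Nat.one_le_floor_iff _ |>.2 (hD1 j)
  · intro X _ μ _ T hT f hf
    have hff : f = ![f 0, f 1] := by
      ext i x
      fin_cases i <;> rfl
    have h := hC X μ T hT (f 0) (f 1) (hf 0) (hf 1)
    rw [← hff] at h
    rw [Fin.prod_univ_two]
    refine le_trans (eLpNorm_mono_enorm fun x => ?_) h
    simp only [enorm_eq_self]
    -- The supremum part of the full norm is discarded; the seminorm alone is already unbounded.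
    refine le_trans ?_ le_add_self
    refine rVariation_natFloor_le r (fun N : ℝ => polyErgodicAverage T ![Polynomial.X, P] f N x) ?_
    intro N
    simp only [polyErgodicAverage, Nat.floor_natCast]
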